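/- Let $\varepsilon_1,\mu_1,\varepsilon_2,\mu_2:\mathbb R\to(0,\infty)$ be piecewise continuous functions (finitely many discontinuities on each bounded interval, finite one-sided limits everywhere) that are periodic with period $1$. For given coefficients $\varepsilon,\mu$ and $E\in\mathbb C$, a solution of $$-\frac1{\varepsilon}\Big(\frac1{\mu}\psi'\Big)'=E\psi$$ on an interval means a function $\psi$ such that $\psi$ and the flux $\frac1\mu\psi'$ are continuous on the interval and the equation holds at all interior points where $\varepsilon$ and $\mu$ are continuous; the values of $\frac1\mu\psi'$ at discontinuities and at end points are the limits. Infinite structure: let $\varepsilon=\varepsilon_1,\mu=\mu_1$ for $x<0$ and $\varepsilon=\varepsilon_2,\mu=\mu_2$ for $x>0$. Suppose that it has an interface mode with energy $E_\infty\in\mathbb R$, that is, a nonzero solution $\psi_\infty\in L^2(\mathbb R)$ of the equation with $E=E_\infty$ on $\mathbb R$. Put $\omega_\infty=\sqrt{E_\infty}$. Finite structure: for integers $N_1<0<N_2$ let $\varepsilon_N,\mu_N$ be equal to these coefficients on $(N_1,N_2)$ and equal to $1$ elsewhere. A resonance of the finite structure is a number $\omega\in\mathbb C$ for which there is a nonzero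 solution $\psi$ on $[N_1,N_2]$ of the equation with coefficients $\varepsilon_N,\mu_N$ and $E=\omega^2$ that satisfies the outgoing conditions $$\frac1{\mu_N}\psi'(N_1)+i\omega\psi(N_1)=0,\qquad \frac1{\mu_N}\psi'(N_2)-i\omega\psi(N_2)=0 .$$ Then there are $\delta>0$, $C>0$, a continuous function $\alpha:\{\omega\in\mathbb C:|\omega-\omega_\infty|\le\delta\}\to(0,\infty)$ and an integer $N_0$, all independent of $N_1,N_2$, such that for all integers $N_1<0<N_2$ with $N:=\min\{|N_1|,N_2\}\ge N_0$ the finite structure has a resonance $\omega$ with $|\omega-\omega_\infty|<\delta$ and $\operatorname{Im}\omega<0$, and every resonance $\omega$ of the finite structure with $|\omega-\omega_\infty|<\delta$ satisfies $$|\omega-\omega_\infty|\le C\,e^{-\alpha(\omega)N}.$$ -/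

import Mathlib

open Set Filter Topology MeasureTheory

noncomputable section

/-- `f` is piecewise continuous: on every bounded interval it has only finitely many points of
discontinuity, and it has finite one-sided limits at every point. -/
def PiecewiseContinuous (f : ℝ → ℝ) : Prop :=
  (∀ a b : ℝ, {x ∈ Icc a b | ¬ ContinuousAt f x}.Finite) ∧
    ∀ x : ℝ, (∃ l : ℝ, Tendsto f (𝓝[<] x) (𝓝 l)) ∧ (∃ r : ℝ, Tendsto f (𝓝[>] x) (𝓝 r))

/-- An admissible material coefficient (permittivity or permeability) of a periodic structure:
positive, piecewise continuous, and periodic with period one. -/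
structure IsPeriodicCoeff (f : ℝ → ℝ) : Prop where
  pos : ∀ x, 0 < f x
  periodic : Function.Periodic f 1
  piecewiseContinuous : PiecewiseContinuous f

/-- `ψ` solves `-(1/ε) ((1/μ) ψ')' = E ψ` on `s` (an interval), with flux `q = (1/μ) ψ'`:
the field `ψ` and the flux `q` are continuous on `s`, and at every interior point at which the
coefficients are continuous, `ψ' = μ q` and `q' = -E ε ψ`. -/
structure IsFieldOn (ε μ : ℝ → ℝ) (E : ℂ) (s : Set ℝ) (ψ q : ℝ → ℂ) : Prop where
  continuousOn_field : ContinuousOn ψ s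
  continuousOn_flux : ContinuousOn q s
  hasDerivAt_field : ∀ x ∈ interior s, ContinuousAt ε x → ContinuousAt μ x →
    HasDerivAt ψ ((μ x : ℂ) * q x) x
  hasDerivAt_flux : ∀ x ∈ interior s, ContinuousAt ε x → ContinuousAt μ x →
    HasDerivAt q (-E * (ε x : ℂ) * ψ x) x

/-- The coefficient of the infinite two-sided structure: `f₁` for `x < 0`, `f₂` for `x > 0`
(the value at the single point `0` is immaterial). -/
def infiniteCoeff (f₁ f₂ : ℝ → ℝ) (x : ℝ) : ℝ :=
  if x < 0 then f₁ x else f₂ x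

/-- The coefficient of the truncated structure: `f₁` on `(N₁, 0)`, `f₂` on `(0, N₂)`, and `1`
outside `(N₁, N₂)` (the value at the single point `0` is immaterial). -/
def finiteCoeff (N₁ N₂ : ℤ) (f₁ f₂ : ℝ → ℝ) (x : ℝ) : ℝ :=
  if (N₁ : ℝ) < x ∧ x < (N₂ : ℝ) then infiniteCoeff f₁ f₂ x else 1

/-- `ψ` is an interface mode, with energy level `E`, of the infinite structure: a nontrivial
square integrable solution on the whole line of the equation with coefficients
`(ε₁, μ₁)` for `x < 0` and `(ε₂, μ₂)` for `x > 0`. -/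
def IsInterfaceMode (ε₁ μ₁ ε₂ μ₂ : ℝ → ℝ) (E : ℝ) (ψ : ℝ → ℂ) : Prop :=
  MemLp ψ 2 volume ∧ (∃ x, ψ x ≠ 0) ∧
    ∃ q : ℝ → ℂ, IsFieldOn (infiniteCoeff ε₁ ε₂) (infiniteCoeff μ₁ μ₂) (E : ℂ) univ ψ q

/-- `ω` is a resonance of the structure truncated to `(N₁, N₂)`: the equation with `E = ω ^ 2`
has a nontrivial solution on `[N₁, N₂]` (a quasi-normal mode) whose field `ψ` and flux
`q = (1/μ) ψ'` satisfy the outgoing conditions `q + iωψ = 0` at `N₁` and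
`q - iωψ = 0` at `N₂`. -/
def IsResonance (N₁ N₂ : ℤ) (ε₁ μ₁ ε₂ μ₂ : ℝ → ℝ) (ω : ℂ) : Prop :=
  ∃ ψ q : ℝ → ℂ,
    IsFieldOn (finiteCoeff N₁ N₂ ε₁ ε₂) (finiteCoeff N₁ N₂ μ₁ μ₂) (ω ^ 2)
      (Icc (N₁ : ℝ) (N₂ : ℝ)) ψ q ∧
    (∃ x ∈ Icc (N₁ : ℝ) (N₂ : ℝ), ψ x ≠ 0) ∧
    q N₁ + Complex.I * ω * ψ N₁ = 0 ∧
    q N₂ - Complex.I * ω * ψ N₂ = 0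

end

open scoped ComplexConjugate

/-! A solution is determined by its data (field, flux) at the interface, so both the mode and the
resonances become linear conditions on a vector in `ℂ²`. First, the mode energy is positive: at a
nonpositive energy the modulus of a solution would be nondecreasing along one of the two half-lines,
which square integrability excludes.

On a half-line (the left one is reflected) the one-period transfer matrix has determinant 1. A
decaying solution at the mode energy forces its trace out of `[-2, 2]`, so near `ωinf` there is a
holomorphic eigenvalue `l` with `‖l‖ ≤ θ < 1`, the other being `1 / l`. After multiplication by `l ^
n`, the outgoing condition at the `n`-th period reads `(g + l ^ (2 * n) * h) · data = 0`, and `g ·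
data = 0` forces decay (`exists_outgoing_asymptotics`). Eliminating the data from the two sides, the
resonances are the zeros of a holomorphic `D` that differs by `O(θ ^ (2 * N))` from a function `F`,
independent of the truncation, with `F ωinf = 0`.

`F` does not vanish identically near `ωinf`: at a point where `ω ^ 2` has positive imaginary part, a
zero of `F` would give a solution decaying at both ends, whereas `Im (conj ψ * q)` is nonincreasing
and can only tend to zero at both ends if the solution is zero (`data_eq_zero_of_decay`). Hence `F`
has a zero of finite order `k` and `c * ‖ω - ωinf‖ ^ k ≤ ‖F ω‖` nearby. The maximum principle for `1
/ D` produces a zero of `D`, and the lower bound places every zero within `O(θ ^ (2 * N / k))` of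
`ωinf` (`AnalyticAt.exists_zeros_of_perturbation`). So the rate `α` can be taken constant. The same
monotone quantity, evaluated with the outgoing conditions, gives `Im ω < 0`. -/

/-- A pair of positive coefficients bounded by `M` whose discontinuities are locally finite. -/
structure IsMedium (ε μ : ℝ → ℝ) (M : ℝ) : Prop where
  pos_left : ∀ x, 0 < ε x
  pos_right : ∀ x, 0 < μ x
  le_left : ∀ x, ε x ≤ M
  le_right : ∀ x, μ x ≤ M
  finite : ∀ a b : ℝ, {x ∈ Icc a b | ¬(ContinuousAt ε x ∧ ContinuousAt μ x)}.Finite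

/-! ### Monotonicity and vanishing across jumps of the coefficients -/

/-- Induction on the exceptional set: an exceptional point inside the interval splits it in two, and
continuity glues the pieces. -/
theorem le_of_hasDerivAt_nonpos_off_finite {f : ℝ → ℝ} {S : Set ℝ} (hS : S.Finite) :
    ∀ a b : ℝ, a ≤ b → ContinuousOn f (Icc a b) →
      (∀ x ∈ Ioo a b, x ∉ S → ∃ f', HasDerivAt f f' x ∧ f' ≤ 0) → f b ≤ f a := by
  induction S, hS using Set.Finite.induction_on with
  | empty =>
    intro a b hab hc hd
    have h : AntitoneOn f (Icc a b) := by
      apply antitoneOn_of_deriv_nonpos (convex_Icc a b) hc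
      · intro x hx
        rw [interior_Icc] at hx
        obtain ⟨f', h1, -⟩ := hd x hx (by simp)
        exact h1.differentiableAt.differentiableWithinAt
      · intro x hx
        rw [interior_Icc] at hx
        obtain ⟨f', h1, h2⟩ := hd x hx (by simp)
        rwa [h1.deriv]
    exact h (left_mem_Icc.2 hab) (right_mem_Icc.2 hab) hab
  | @insert s S _ _ ih =>
    intro a b hab hc hd
    by_cases hs : s ∈ Ioo a b
    · have h1 : f s ≤ f a := by
        refine ih a s hs.1.le (hc.mono (Icc_subset_Icc_right hs.2.le)) fun x hx hxS => ?_
        exact hd x ⟨hx.1, hx.2.trans hs.2⟩ (by simp [hxS, hx.2.ne])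
      have h2 : f b ≤ f s := by
        refine ih s b hs.2.le (hc.mono (Icc_subset_Icc_left hs.1.le)) fun x hx hxS => ?_
        exact hd x ⟨hs.1.trans hx.1, hx.2⟩ (by simp [hxS, hx.1.ne'])
      exact h2.trans h1
    · refine ih a b hab hc fun x hx hxS => hd x hx ?_
      rintro (rfl | h)
      · exact hs hx
      · exact hxS h

theorem IsMedium.antitoneOn {ε μ : ℝ → ℝ} {M : ℝ} (hm : IsMedium ε μ M) {f : ℝ → ℝ} {a b : ℝ}
    (hc : ContinuousOn f (Icc a b))
    (hd : ∀ x ∈ Ioo a b, ContinuousAt ε x → ContinuousAt μ x → ∃ f', HasDerivAt f f' x ∧ f' ≤ 0) :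
    AntitoneOn f (Icc a b) := by
  intro x hx y hy hxy
  refine le_of_hasDerivAt_nonpos_off_finite (hm.finite x y) x y hxy
    (hc.mono (Icc_subset_Icc hx.1 hy.2)) fun z hz hzS => ?_
  have h : ContinuousAt ε z ∧ ContinuousAt μ z := by
    by_contra h
    exact hzS ⟨Ioo_subset_Icc_self hz, h⟩
  exact hd z ⟨hx.1.trans_lt hz.1, hz.2.trans_le hy.2⟩ h.1 h.2

/-- The points of continuity are cocountable, hence dense, and `f` is continuous. -/
theorem IsMedium.eq_zero_of_regular {ε μ : ℝ → ℝ} {M : ℝ} (hm : IsMedium ε μ M) {f : ℝ → ℂ}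
    {a b : ℝ} (hab : a < b) (hc : ContinuousOn f (Icc a b))
    (hd : ∀ x ∈ Ioo a b, ContinuousAt ε x → ContinuousAt μ x → f x = 0) :
    ∀ x ∈ Icc a b, f x = 0 := by
  set S := {x ∈ Icc a b | ¬(ContinuousAt ε x ∧ ContinuousAt μ x)} with hS
  have hdense : Dense Sᶜ := (hm.finite a b).countable.dense_compl ℝ
  have hcl : Icc a b ⊆ closure (Ioo a b ∩ Sᶜ) := by
    rw [← closure_Ioo hab.ne]
    exact closure_minimal (hdense.open_subset_closure_inter isOpen_Ioo) isClosed_closure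
  have hz : EqOn f (fun _ => 0) (Ioo a b ∩ Sᶜ) := by
    rintro x ⟨hx, hxS⟩
    have h : ContinuousAt ε x ∧ ContinuousAt μ x := by
      by_contra h
      exact hxS ⟨Ioo_subset_Icc_self hx, h⟩
    exact hd x hx h.1 h.2
  exact hz.of_subset_closure hc continuousOn_const
    (inter_subset_left.trans Ioo_subset_Icc_self) hcl

/-! ### Symmetries of the equation, energy flux and uniqueness -/

namespace IsFieldOn

variable {ε μ : ℝ → ℝ} {E : ℂ} {s : Set ℝ} {ψ q : ℝ → ℂ} {M : ℝ}

theorem congr_coeff (h : IsFieldOn ε μ E s ψ q) {ε' μ' : ℝ → ℝ} {t : Set ℝ} (hts : t ⊆ s)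
    (hε : EqOn ε ε' (interior t)) (hμ : EqOn μ μ' (interior t)) : IsFieldOn ε' μ' E t ψ q := by
  have key : ∀ x ∈ interior t, ε =ᶠ[𝓝 x] ε' ∧ μ =ᶠ[𝓝 x] μ' := fun x hx =>
    ⟨hε.eventuallyEq_of_mem (isOpen_interior.mem_nhds hx),
      hμ.eventuallyEq_of_mem (isOpen_interior.mem_nhds hx)⟩
  refine ⟨h.1.mono hts, h.2.mono hts, fun x hx h1 h2 => ?_, fun x hx h1 h2 => ?_⟩
  · rw [← hμ hx]
    exact h.3 x (interior_mono hts hx) (h1.congr (key x hx).1.symm) (h2.congr (key x hx).2.symm)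
  · rw [← hε hx]
    exact h.4 x (interior_mono hts hx) (h1.congr (key x hx).1.symm) (h2.congr (key x hx).2.symm)

theorem mono (h : IsFieldOn ε μ E s ψ q) {t : Set ℝ} (hts : t ⊆ s) : IsFieldOn ε μ E t ψ q :=
  h.congr_coeff hts (fun _ _ => rfl) (fun _ _ => rfl)

theorem lincomb (h : IsFieldOn ε μ E s ψ q) {ψ' q' : ℝ → ℂ} (h' : IsFieldOn ε μ E s ψ' q')
    (a b : ℂ) :
    IsFieldOn ε μ E s (fun x => a * ψ x + b * ψ' x) (fun x => a * q x + b * q' x) := by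
  refine ⟨(continuousOn_const.mul h.1).add (continuousOn_const.mul h'.1),
    (continuousOn_const.mul h.2).add (continuousOn_const.mul h'.2),
    fun x hx h1 h2 => ?_, fun x hx h1 h2 => ?_⟩
  · refine (((h.3 x hx h1 h2).const_mul a).add ((h'.3 x hx h1 h2).const_mul b)).congr_deriv ?_
    ring
  · refine (((h.4 x hx h1 h2).const_mul a).add ((h'.4 x hx h1 h2).const_mul b)).congr_deriv ?_
    ring

/-- Reversing the line changes the sign of the flux. This reduces every statement about a left
half-line to one about a right half-line. -/
theorem reflect (h : IsFieldOn ε μ E s ψ q) :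
    IsFieldOn (fun x => ε (-x)) (fun x => μ (-x)) E (Neg.neg ⁻¹' s) (fun x => ψ (-x))
      (fun x => -q (-x)) := by
  have hi : ∀ x, x ∈ interior (Neg.neg ⁻¹' s : Set ℝ) → -x ∈ interior s := fun x hx => by
    have := (Homeomorph.neg ℝ).preimage_interior s
    simp only [Homeomorph.coe_neg] at this
    rw [← this] at hx
    exact hx
  have hn : ∀ x : ℝ, HasDerivAt (fun x : ℝ => -x) (-1) x := fun x => hasDerivAt_neg x
  have hct : ∀ (f : ℝ → ℝ) (x : ℝ), ContinuousAt (fun x => f (-x)) x → ContinuousAt f (-x) := by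
    intro f x hf
    have h2 : ContinuousAt (fun y : ℝ => -y) (-x) := continuous_neg.continuousAt
    have := ContinuousAt.comp_of_eq (f := fun y : ℝ => -y) (x := -x) hf h2 (neg_neg x)
    simpa [Function.comp_def] using this
  refine ⟨h.1.comp continuous_neg.continuousOn (mapsTo_preimage _ _),
    (h.2.comp continuous_neg.continuousOn (mapsTo_preimage _ _)).neg,
    fun x hx h1 h2 => ?_, fun x hx h1 h2 => ?_⟩
  · have := (h.3 (-x) (hi x hx) (hct _ _ h1) (hct _ _ h2)).scomp x (hn x)
    refine this.congr_deriv ?_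
    simp
  · have := ((h.4 (-x) (hi x hx) (hct _ _ h1) (hct _ _ h2)).scomp x (hn x)).neg
    refine this.congr_deriv ?_
    simp

theorem shift (h : IsFieldOn ε μ E s ψ q) (c : ℝ) :
    IsFieldOn (fun x => ε (x + c)) (fun x => μ (x + c)) E ((fun x => x + c) ⁻¹' s)
      (fun x => ψ (x + c)) (fun x => q (x + c)) := by
  have hi : ∀ x, x ∈ interior ((fun x => x + c) ⁻¹' s : Set ℝ) → x + c ∈ interior s :=
    fun x hx => by
      have := (Homeomorph.addRight c).preimage_interior s
      simp only [Homeomorph.coe_addRight] at this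
      rw [← this] at hx
      exact hx
  have hct : ∀ (f : ℝ → ℝ) (x : ℝ), ContinuousAt (fun x => f (x + c)) x →
      ContinuousAt f (x + c) := by
    intro f x hf
    have h2 : ContinuousAt (fun y : ℝ => y - c) (x + c) := by fun_prop
    have := ContinuousAt.comp_of_eq (f := fun y : ℝ => y - c) (x := x + c) hf h2 (by ring)
    simpa [Function.comp_def] using this
  have hcc : ContinuousOn (fun x : ℝ => x + c) ((fun x => x + c) ⁻¹' s) := by fun_prop
  refine ⟨h.1.comp hcc (mapsTo_preimage _ _), h.2.comp hcc (mapsTo_preimage _ _),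
    fun x hx h1 h2 => ?_, fun x hx h1 h2 => ?_⟩
  · exact (h.3 (x + c) (hi x hx) (hct _ _ h1) (hct _ _ h2)).comp_add_const x c
  · exact (h.4 (x + c) (hi x hx) (hct _ _ h1) (hct _ _ h2)).comp_add_const x c

theorem conjugate (h : IsFieldOn ε μ E s ψ q) :
    IsFieldOn ε μ (conj E) s (fun x => conj (ψ x)) (fun x => conj (q x)) := by
  refine ⟨Complex.continuous_conj.comp_continuousOn h.1,
    Complex.continuous_conj.comp_continuousOn h.2,
    fun x hx h1 h2 => ?_, fun x hx h1 h2 => ?_⟩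
  · refine (h.3 x hx h1 h2).star.congr_deriv ?_
    simp [mul_comm]
  · refine (h.4 x hx h1 h2).star.congr_deriv ?_
    simp [mul_comm, mul_left_comm]

/-- The derivative of the sesquilinear form `conj ψ * q`. -/
theorem hasDerivAt_conj_mul (h : IsFieldOn ε μ E s ψ q) {x : ℝ} (hx : x ∈ interior s)
    (h1 : ContinuousAt ε x) (h2 : ContinuousAt μ x) :
    HasDerivAt (fun x => conj (ψ x) * q x)
      ((μ x * ‖q x‖ ^ 2 : ℝ) - E * (ε x * ‖ψ x‖ ^ 2 : ℝ)) x := by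
  refine ((h.3 x hx h1 h2).star.mul (h.4 x hx h1 h2)).congr_deriv ?_
  have e1 := Complex.conj_mul' (q x)
  have e2 := Complex.conj_mul' (ψ x)
  push_cast
  rw [← e1, ← e2]
  simp only [Complex.star_def, map_mul, Complex.conj_ofReal]
  ring

/-- The derivative is `-E.im * ε * ‖ψ‖ ^ 2`, since the term `μ * ‖q‖ ^ 2` is real. -/
theorem antitoneOn_im (h : IsFieldOn ε μ E s ψ q) (hm : IsMedium ε μ M) {a b : ℝ}
    (hs : Icc a b ⊆ s) (hE : 0 ≤ E.im) :
    AntitoneOn (fun x => (conj (ψ x) * q x).im) (Icc a b) := by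
  replace h := h.mono hs
  refine hm.antitoneOn ?_ fun x hx h1 h2 => ⟨_, HasFDerivAt.comp_hasDerivAt x
    Complex.imCLM.hasFDerivAt (h.hasDerivAt_conj_mul (by rwa [interior_Icc]) h1 h2), ?_⟩
  · exact Complex.continuous_im.comp_continuousOn
      ((Complex.continuous_conj.comp_continuousOn h.1).mul h.2)
  · simp only [Complex.imCLM_apply, Complex.sub_im, Complex.ofReal_im, Complex.mul_im, mul_zero,
      zero_add, zero_sub, Complex.ofReal_re, Left.neg_nonpos_iff]
    have := hm.pos_left x
    positivity

/-- A nonincreasing function that does not drop between the ends is constant, so its derivative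
`-E.im * ε * ‖ψ‖ ^ 2` vanishes at the regular points. -/
theorem eq_zero_of_im_eq (h : IsFieldOn ε μ E s ψ q) (hm : IsMedium ε μ M) {a b : ℝ}
    (hab : a < b) (hs : Icc a b ⊆ s) (hE : 0 < E.im)
    (hle : (conj (ψ a) * q a).im ≤ (conj (ψ b) * q b).im) : ∀ x ∈ Icc a b, ψ x = 0 := by
  replace h := h.mono hs
  have hanti := h.antitoneOn_im hm subset_rfl hE.le
  refine hm.eq_zero_of_regular hab h.1 fun x hx h1 h2 => ?_
  have hd := HasFDerivAt.comp_hasDerivAt x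
    Complex.imCLM.hasFDerivAt (h.hasDerivAt_conj_mul (by rwa [interior_Icc]) h1 h2)
  have hconst : (fun x => (conj (ψ x) * q x).im) =ᶠ[𝓝 x] fun _ => (conj (ψ a) * q a).im := by
    filter_upwards [Ioo_mem_nhds hx.1 hx.2] with y hy
    have hy' := Ioo_subset_Icc_self hy
    apply le_antisymm
    · exact hanti (left_mem_Icc.2 hab.le) hy' hy'.1
    · exact hle.trans (hanti hy' (right_mem_Icc.2 hab.le) hy'.2)
  have h0 := (hd.congr_of_eventuallyEq (f₁ := fun _ => (conj (ψ a) * q a).im)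
    hconst.symm).unique (hasDerivAt_const x _)
  simp only [Complex.imCLM_apply, Complex.sub_im, Complex.ofReal_im, Complex.mul_im, mul_zero,
    zero_add, zero_sub, Complex.ofReal_re, neg_eq_zero, mul_eq_zero] at h0
  have := (hm.pos_left x).ne'
  simpa [this, hE.ne'] using h0

/-- A Grönwall argument: `‖ψ‖ ^ 2 + ‖q‖ ^ 2` grows at most at the exponential rate `K`, so with the
weight `exp (-K * x)` it is nonincreasing, and it starts from zero. -/
theorem eq_zero_of_left (h : IsFieldOn ε μ E s ψ q) (hm : IsMedium ε μ M) {a b : ℝ}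
    (hs : Icc a b ⊆ s) (h0 : ψ a = 0) (h0' : q a = 0) : ∀ x ∈ Icc a b, ψ x = 0 ∧ q x = 0 := by
  replace h := h.mono hs
  intro x hx
  have hab : a ≤ b := hx.1.trans hx.2
  set K := M * (1 + ‖E‖) with hK
  have hanti : AntitoneOn (fun x => (‖ψ x‖ ^ 2 + ‖q x‖ ^ 2) * Real.exp (-K * x)) (Icc a b) := by
    refine hm.antitoneOn ?_ fun x hx h1 h2 => ⟨_, ((h.3 x (by rwa [interior_Icc]) h1
      h2).norm_sq.add (h.4 x (by rwa [interior_Icc]) h1 h2).norm_sq).mul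
      (((hasDerivAt_id x).const_mul (-K)).exp), ?_⟩
    · have h1 := h.1
      have h2 := h.2
      fun_prop
    · have i1 := real_inner_le_norm (ψ x) (μ x * q x)
      have i2 := real_inner_le_norm (q x) (-E * ε x * ψ x)
      simp only [norm_mul, norm_neg, Complex.norm_real, Real.norm_eq_abs,
        abs_of_pos (hm.pos_left x), abs_of_pos (hm.pos_right x)] at i1 i2
      have j1 : ‖ψ x‖ * (μ x * ‖q x‖) ≤ M * (‖ψ x‖ * ‖q x‖) := by
        nlinarith [mul_nonneg (norm_nonneg (ψ x)) (norm_nonneg (q x)), hm.le_right x]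
      have j2 : ‖q x‖ * (‖E‖ * ε x * ‖ψ x‖) ≤ M * ‖E‖ * (‖ψ x‖ * ‖q x‖) := by
        nlinarith [mul_nonneg (mul_nonneg (norm_nonneg (ψ x)) (norm_nonneg (q x)))
          (norm_nonneg E), hm.le_left x]
      have j3 : 2 * (‖ψ x‖ * ‖q x‖) ≤ ‖ψ x‖ ^ 2 + ‖q x‖ ^ 2 := by
        nlinarith [sq_nonneg (‖ψ x‖ - ‖q x‖)]
      have hK0 : 0 ≤ K := by
        have := (hm.pos_left x).trans_le (hm.le_left x)
        positivity
      have j4 := mul_le_mul_of_nonneg_left j3 hK0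
      have e := Real.exp_pos (-K * x)
      simp only [id, mul_one]
      have : 2 * inner ℝ (ψ x) (μ x * q x) + 2 * inner ℝ (q x) (-E * ε x * ψ x) ≤
          K * (‖ψ x‖ ^ 2 + ‖q x‖ ^ 2) := by
        rw [hK] at j4 ⊢
        linarith
      have := mul_le_mul_of_nonneg_right this e.le
      simp only [Pi.add_apply]
      linarith
  have h1 := hanti (left_mem_Icc.2 hab) hx hx.1
  simp only [h0, h0', norm_zero, ne_eq, OfNat.ofNat_ne_zero, not_false_eq_true, zero_pow,
    add_zero, zero_mul] at h1
  have h2 : ‖ψ x‖ ^ 2 + ‖q x‖ ^ 2 ≤ 0 := nonpos_of_mul_nonpos_left h1 (Real.exp_pos _)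
  constructor
  · have : ‖ψ x‖ ^ 2 = 0 := by nlinarith [sq_nonneg ‖ψ x‖, sq_nonneg ‖q x‖]
    simpa using this
  · have : ‖q x‖ ^ 2 = 0 := by nlinarith [sq_nonneg ‖ψ x‖, sq_nonneg ‖q x‖]
    simpa using this

theorem flux_eq_zero (h : IsFieldOn ε μ E s ψ q) (hm : IsMedium ε μ M) {a b : ℝ}
    (hab : a < b) (hs : Icc a b ⊆ s) (h0 : ∀ x ∈ Icc a b, ψ x = 0) : ∀ x ∈ Icc a b, q x = 0 := by
  replace h := h.mono hs
  refine hm.eq_zero_of_regular hab h.2 fun x hx h1 h2 => ?_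
  have hz : ψ =ᶠ[𝓝 x] fun _ => 0 := by
    filter_upwards [Ioo_mem_nhds hx.1 hx.2] with y hy using h0 y (Ioo_subset_Icc_self hy)
  have := ((h.3 x (by rwa [interior_Icc]) h1 h2).congr_of_eventuallyEq hz.symm).unique
    (hasDerivAt_const x _)
  simpa [(hm.pos_right x).ne'] using this

end IsFieldOn

/-! ### Periodic, two-sided and truncated coefficients as media -/

theorem IsMedium.reflect {ε μ : ℝ → ℝ} {M : ℝ} (hm : IsMedium ε μ M) :
    IsMedium (fun x => ε (-x)) (fun x => μ (-x)) M := by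
  refine ⟨fun x => hm.1 _, fun x => hm.2 _, fun x => hm.3 _, fun x => hm.4 _, fun a b => ?_⟩
  refine ((hm.finite (-b) (-a)).image Neg.neg).subset ?_
  rintro x ⟨hx, hxc⟩
  refine ⟨-x, ⟨⟨neg_le_neg hx.2, neg_le_neg hx.1⟩, fun hc => hxc ⟨?_, ?_⟩⟩, neg_neg x⟩
  · exact ContinuousAt.comp (f := fun x : ℝ => -x) hc.1 continuous_neg.continuousAt
  · exact ContinuousAt.comp (f := fun x : ℝ => -x) hc.2 continuous_neg.continuousAt

theorem IsPeriodicCoeff.reflect {f : ℝ → ℝ} (hf : IsPeriodicCoeff f) :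
    IsPeriodicCoeff (fun x => f (-x)) := by
  refine ⟨fun x => hf.1 _, fun x => ?_, fun a b => ?_, fun x => ⟨?_, ?_⟩⟩
  · have := hf.2 (-(x + 1))
    simp only [neg_add_rev, neg_add_cancel_comm] at this ⊢
    rw [← this]
  · refine ((hf.3.1 (-b) (-a)).image Neg.neg).subset ?_
    rintro x ⟨hx, hxc⟩
    refine ⟨-x, ⟨⟨neg_le_neg hx.2, neg_le_neg hx.1⟩, fun hc => hxc ?_⟩, neg_neg x⟩
    exact ContinuousAt.comp (f := fun x : ℝ => -x) hc continuous_neg.continuousAt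
  · obtain ⟨r, hr⟩ := (hf.3.2 (-x)).2
    exact ⟨r, hr.comp tendsto_neg_nhdsLT⟩
  · obtain ⟨r, hr⟩ := (hf.3.2 (-x)).1
    exact ⟨r, hr.comp tendsto_neg_nhdsGT⟩

/-- One-sided limits give a bound near each point; compactness of a period and periodicity make it
global. -/
theorem IsPeriodicCoeff.exists_le {f : ℝ → ℝ} (hf : IsPeriodicCoeff f) : ∃ M, ∀ x, f x ≤ M := by
  have hb : BddAbove (f '' Icc 0 1) := by
    refine (isCompact_Icc (a := (0 : ℝ)) (b := 1)).induction_on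
      (p := fun s => BddAbove (f '' s)) (by simp)
      (fun s t hst ht => ht.mono (image_mono hst))
      (fun s t hs ht => by rw [image_union]; exact hs.union ht) fun x _ => ?_
    obtain ⟨⟨l, hl⟩, r, hr⟩ := hf.3.2 x
    have h1 : ∀ᶠ y in 𝓝[<] x, f y ≤ max (max (l + 1) (r + 1)) (f x) := by
      filter_upwards [hl.eventually (gt_mem_nhds (lt_add_one l))] with y hy
      exact hy.le.trans ((le_max_left _ _).trans (le_max_left _ _))
    have h2 : ∀ᶠ y in 𝓝[>] x, f y ≤ max (max (l + 1) (r + 1)) (f x) := by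
      filter_upwards [hr.eventually (gt_mem_nhds (lt_add_one r))] with y hy
      exact hy.le.trans ((le_max_right _ _).trans (le_max_left _ _))
    have h3 : ∀ᶠ y in 𝓝 x, f y ≤ max (max (l + 1) (r + 1)) (f x) := by
      rw [← nhdsNE_sup_pure x, ← nhdsLT_sup_nhdsGT]
      simp only [eventually_sup, h1, h2, true_and, eventually_pure]
      exact le_max_right _ _
    exact ⟨_, mem_nhdsWithin_of_mem_nhds h3, _, by rintro _ ⟨y, hy, rfl⟩; exact hy⟩
  obtain ⟨M, hM⟩ := hb
  refine ⟨M, fun x => ?_⟩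
  obtain ⟨y, hy, hxy⟩ := hf.periodic.exists_mem_Ico₀ one_pos x
  rw [hxy]
  exact hM ⟨y, Ico_subset_Icc_self hy, rfl⟩

theorem IsPeriodicCoeff.isMedium {ε μ : ℝ → ℝ} (hε : IsPeriodicCoeff ε) (hμ : IsPeriodicCoeff μ) :
    ∃ M, IsMedium ε μ M := by
  obtain ⟨M₁, h1⟩ := hε.exists_le
  obtain ⟨M₂, h2⟩ := hμ.exists_le
  refine ⟨max M₁ M₂, hε.pos, hμ.pos, fun x => (h1 x).trans (le_max_left _ _),
    fun x => (h2 x).trans (le_max_right _ _), fun a b => ?_⟩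
  refine ((hε.3.1 a b).union (hμ.3.1 a b)).subset ?_
  rintro x ⟨hx, hc⟩
  by_cases h : ContinuousAt ε x
  · exact Or.inr ⟨hx, fun h' => hc ⟨h, h'⟩⟩
  · exact Or.inl ⟨hx, h⟩

theorem infiniteCoeff_eqOn_left (f₁ f₂ : ℝ → ℝ) : EqOn (infiniteCoeff f₁ f₂) f₁ (Iio 0) :=
  fun _ hx => if_pos hx

theorem infiniteCoeff_eqOn_right (f₁ f₂ : ℝ → ℝ) : EqOn (infiniteCoeff f₁ f₂) f₂ (Ioi 0) :=
  fun _ hx => if_neg (not_lt.2 (le_of_lt hx))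

theorem finiteCoeff_eqOn (N₁ N₂ : ℤ) (f₁ f₂ : ℝ → ℝ) :
    EqOn (finiteCoeff N₁ N₂ f₁ f₂) (infiniteCoeff f₁ f₂) (Ioo N₁ N₂) :=
  fun _ hx => if_pos hx

theorem infiniteCoeff_isMedium {ε₁ μ₁ ε₂ μ₂ : ℝ → ℝ} {M₁ M₂ : ℝ} (h1 : IsMedium ε₁ μ₁ M₁)
    (h2 : IsMedium ε₂ μ₂ M₂) :
    IsMedium (infiniteCoeff ε₁ ε₂) (infiniteCoeff μ₁ μ₂) (max M₁ M₂) := by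
  refine ⟨fun x => ?_, fun x => ?_, fun x => ?_, fun x => ?_, fun a b => ?_⟩
  · unfold infiniteCoeff; split_ifs; exacts [h1.1 x, h2.1 x]
  · unfold infiniteCoeff; split_ifs; exacts [h1.2 x, h2.2 x]
  · unfold infiniteCoeff; split_ifs
    exacts [(h1.3 x).trans (le_max_left _ _), (h2.3 x).trans (le_max_right _ _)]
  · unfold infiniteCoeff; split_ifs
    exacts [(h1.4 x).trans (le_max_left _ _), (h2.4 x).trans (le_max_right _ _)]
  · refine (((h1.5 a b).union (h2.5 a b)).union (finite_singleton 0)).subset ?_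
    rintro x ⟨hx, hc⟩
    rcases lt_trichotomy x 0 with h | h | h
    · refine Or.inl (Or.inl ⟨hx, fun h' => hc ⟨h'.1.congr ?_, h'.2.congr ?_⟩⟩) <;>
      exact ((infiniteCoeff_eqOn_left _ _).eventuallyEq_of_mem (Iio_mem_nhds h)).symm
    · exact Or.inr h
    · refine Or.inl (Or.inr ⟨hx, fun h' => hc ⟨h'.1.congr ?_, h'.2.congr ?_⟩⟩) <;>
      exact ((infiniteCoeff_eqOn_right _ _).eventuallyEq_of_mem (Ioi_mem_nhds h)).symm

theorem finiteCoeff_isMedium {ε₁ μ₁ ε₂ μ₂ : ℝ → ℝ} {M : ℝ} (N₁ N₂ : ℤ)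
    (h : IsMedium (infiniteCoeff ε₁ ε₂) (infiniteCoeff μ₁ μ₂) M) :
    IsMedium (finiteCoeff N₁ N₂ ε₁ ε₂) (finiteCoeff N₁ N₂ μ₁ μ₂) (max M 1) := by
  refine ⟨fun x => ?_, fun x => ?_, fun x => ?_, fun x => ?_, fun a b => ?_⟩
  · unfold finiteCoeff; split_ifs; exacts [h.1 x, one_pos]
  · unfold finiteCoeff; split_ifs; exacts [h.2 x, one_pos]
  · unfold finiteCoeff; split_ifs
    exacts [(h.3 x).trans (le_max_left _ _), le_max_right _ _]
  · unfold finiteCoeff; split_ifs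
    exacts [(h.4 x).trans (le_max_left _ _), le_max_right _ _]
  · refine ((h.5 a b).union (toFinite {(N₁ : ℝ), (N₂ : ℝ)})).subset ?_
    rintro x ⟨hx, hc⟩
    by_cases hx1 : x = N₁
    · exact Or.inr (Or.inl hx1)
    by_cases hx2 : x = N₂
    · exact Or.inr (Or.inr hx2)
    by_cases hin : x ∈ Ioo (N₁ : ℝ) N₂
    · refine Or.inl ⟨hx, fun h' => hc ⟨h'.1.congr ?_, h'.2.congr ?_⟩⟩ <;>
      exact ((finiteCoeff_eqOn _ _ _ _).eventuallyEq_of_mem (Ioo_mem_nhds hin.1 hin.2)).symm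
    · exfalso
      have hout : x ∈ (Icc (N₁ : ℝ) N₂)ᶜ := fun hI =>
        hin ⟨lt_of_le_of_ne hI.1 (Ne.symm hx1), lt_of_le_of_ne hI.2 hx2⟩
      have key : ∀ f₁ f₂ : ℝ → ℝ, ContinuousAt (finiteCoeff N₁ N₂ f₁ f₂) x := fun f₁ f₂ => by
        refine (continuousAt_const (y := (1 : ℝ))).congr ?_
        filter_upwards [isClosed_Icc.isOpen_compl.mem_nhds hout] with y hy
        exact (if_neg fun h => hy ⟨h.1.le, h.2.le⟩).symm
      exact hc ⟨key _ _, key _ _⟩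

/-! ### Solutions as power series in the energy -/

theorem IsMedium.measurable {ε μ : ℝ → ℝ} {M : ℝ} (hm : IsMedium ε μ M) :
    Measurable ε ∧ Measurable μ := by
  have hcount : ({x : ℝ | ContinuousAt ε x ∧ ContinuousAt μ x}ᶜ).Countable := by
    refine (countable_iUnion fun n : ℕ => (hm.finite (-n) n).countable).mono fun x hx => ?_
    obtain ⟨n, hn⟩ := exists_nat_ge |x|
    exact mem_iUnion.2 ⟨n, abs_le.1 hn, hx⟩
  exact ⟨ContinuousOn.measurable_of_countable_compl (fun x hx => hx.1.continuousWithinAt) hcount,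
    ContinuousOn.measurable_of_countable_compl (fun x hx => hx.2.continuousWithinAt) hcount⟩

/-- The primitive of `w f` vanishing at `0`. -/
noncomputable def weightedPrimitive (w : ℝ → ℝ) (f : ℝ → ℂ) (x : ℝ) : ℂ :=
  ∫ t in (0 : ℝ)..x, (w t : ℂ) * f t

section WeightedPrimitive

variable {w : ℝ → ℝ} {M : ℝ} {f : ℝ → ℂ}

theorem intervalIntegrable_weight_mul (hw : Measurable w) (hM : ∀ x, |w x| ≤ M)
    (hf : Continuous f) (a b : ℝ) : IntervalIntegrable (fun t => (w t : ℂ) * f t) volume a b := by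
  refine IntervalIntegrable.mul_continuousOn ?_ hf.continuousOn
  refine (intervalIntegrable_const (c := M)).mono_fun
    (Complex.measurable_ofReal.comp hw).aestronglyMeasurable (ae_of_all _ fun x => ?_)
  simpa using (hM x).trans (le_abs_self M)

theorem continuous_weightedPrimitive (hw : Measurable w) (hM : ∀ x, |w x| ≤ M)
    (hf : Continuous f) : Continuous (weightedPrimitive w f) :=
  intervalIntegral.continuous_primitive (intervalIntegrable_weight_mul hw hM hf) 0

theorem hasDerivAt_weightedPrimitive (hw : Measurable w) (hM : ∀ x, |w x| ≤ M)
    (hf : Continuous f) {x : ℝ} (hx : ContinuousAt w x) :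
    HasDerivAt (weightedPrimitive w f) (w x * f x) x := by
  refine intervalIntegral.integral_hasDerivAt_right (intervalIntegrable_weight_mul hw hM hf 0 x)
    ?_ ((Complex.continuous_ofReal.continuousAt.comp hx).mul hf.continuousAt)
  exact ((Complex.measurable_ofReal.comp hw).mul
    hf.measurable).stronglyMeasurable.stronglyMeasurableAtFilter

theorem norm_weightedPrimitive_le (hM : ∀ x, |w x| ≤ M) {K : ℝ} {n : ℕ} {x : ℝ}
    (hK : ∀ t, |t| ≤ |x| → ‖f t‖ ≤ K * |t| ^ n) :
    ‖weightedPrimitive w f x‖ ≤ M * K * |x| ^ (n + 1) / (n + 1) := by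
  have hM0 : 0 ≤ M := (abs_nonneg _).trans (hM 0)
  have key : ∀ g : ℝ → ℂ, ∀ y, 0 ≤ y → (∀ t ∈ Ioc 0 y, ‖g t‖ ≤ M * (K * t ^ n)) →
      ‖∫ t in (0 : ℝ)..y, g t‖ ≤ M * K * y ^ (n + 1) / (n + 1) := by
    intro g y hy hg
    refine (intervalIntegral.norm_integral_le_of_norm_le hy (g := fun t => M * (K * t ^ n))
      (ae_of_all _ hg) (Continuous.intervalIntegrable (by fun_prop) _ _)).trans_eq ?_
    rw [intervalIntegral.integral_const_mul, intervalIntegral.integral_const_mul, integral_pow]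
    simp
    ring
  have hpt : ∀ t, |t| ≤ |x| → ‖(w t : ℂ) * f t‖ ≤ M * (K * |t| ^ n) := fun t ht => by
    rw [norm_mul, Complex.norm_real, Real.norm_eq_abs]
    exact mul_le_mul (hM t) (hK t ht) (norm_nonneg _) hM0
  rcases le_total 0 x with hx | hx
  · rw [abs_of_nonneg hx] at *
    refine key _ x hx fun t ht => ?_
    have h := hpt t (by rw [abs_of_pos ht.1]; exact ht.2)
    rwa [abs_of_pos ht.1] at h
  · rw [abs_of_nonpos hx] at *
    have e : weightedPrimitive w f x = -∫ t in (0 : ℝ)..(-x), (w (-t) : ℂ) * f (-t) := by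
      rw [intervalIntegral.integral_comp_neg (fun t => (w t : ℂ) * f t), neg_neg, neg_zero,
        ← intervalIntegral.integral_symm]
      rfl
    rw [e, norm_neg]
    refine key _ (-x) (neg_nonneg.2 hx) fun t ht => ?_
    have h := hpt (-t) (by rw [abs_neg, abs_of_pos ht.1]; exact ht.2)
    rwa [abs_neg, abs_of_pos ht.1] at h

theorem hasSum_weightedPrimitive (hw : Measurable w) (hM : ∀ x, |w x| ≤ M) {F : ℕ → ℝ → ℂ}
    (hF : ∀ n, Continuous (F n)) {x : ℝ} {u : ℕ → ℝ} (hu : Summable u)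
    (hFu : ∀ n t, |t| ≤ |x| → ‖F n t‖ ≤ u n) :
    HasSum (fun n => weightedPrimitive w (F n) x)
      (weightedPrimitive w (fun t => ∑' n, F n t) x) := by
  have hM0 : 0 ≤ M := (abs_nonneg _).trans (hM 0)
  have habs : ∀ t ∈ uIoc 0 x, |t| ≤ |x| := fun t ht => by
    rcases le_total 0 x with hx | hx
    · rw [uIoc_of_le hx] at ht
      rw [abs_of_pos ht.1, abs_of_nonneg hx]; exact ht.2
    · rw [uIoc_of_ge hx] at ht
      rw [abs_of_nonpos ht.2, abs_of_nonpos hx]; linarith [ht.1]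
  refine intervalIntegral.hasSum_integral_of_dominated_convergence (fun n _ => M * u n)
    (fun n => ?_) (fun n => ae_of_all _ fun t ht => ?_) (ae_of_all _ fun t _ => hu.mul_left M)
    intervalIntegrable_const (ae_of_all _ fun t ht => ?_)
  · exact ((Complex.measurable_ofReal.comp hw).mul (hF n).measurable).aestronglyMeasurable
  · rw [norm_mul, Complex.norm_real, Real.norm_eq_abs]
    exact mul_le_mul (hM t) (hFu n t (habs t ht)) (norm_nonneg _) hM0
  · exact (Summable.of_norm_bounded hu fun n => hFu n t (habs t ht)).hasSum.mul_left _

end WeightedPrimitive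

/-- The coefficients of the expansion in powers of the energy of the solution with field `a` and
flux `b` at the origin. -/
noncomputable def energyCoeff (ε μ : ℝ → ℝ) (a b : ℂ) : ℕ → (ℝ → ℂ) × (ℝ → ℂ)
  | 0 => (fun x => a + weightedPrimitive μ (fun _ => b) x, fun _ => b)
  | n + 1 => (weightedPrimitive μ fun x => -weightedPrimitive ε (energyCoeff ε μ a b n).1 x,
      fun x => -weightedPrimitive ε (energyCoeff ε μ a b n).1 x)

section EnergySeries

variable {ε μ : ℝ → ℝ} {M : ℝ}

theorem continuous_energyCoeff (hε : Measurable ε) (hμ : Measurable μ) (hεM : ∀ x, |ε x| ≤ M)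
    (hμM : ∀ x, |μ x| ≤ M) (a b : ℂ) (n : ℕ) :
    Continuous (energyCoeff ε μ a b n).1 ∧ Continuous (energyCoeff ε μ a b n).2 := by
  induction n with
  | zero =>
    exact ⟨continuous_const.add (continuous_weightedPrimitive hμ hμM continuous_const),
      continuous_const⟩
  | succ n ih =>
    have h := (continuous_weightedPrimitive hε hεM ih.1).neg
    exact ⟨continuous_weightedPrimitive hμ hμM h, h⟩

/-- Each step integrates twice. One integration supplies the factor `|x| / (n + 1)` that builds the
factorial; the other is only bounded through `R`, so that field and flux share one estimate. -/
theorem norm_energyCoeff_le (hεM : ∀ x, |ε x| ≤ M) (hμM : ∀ x, |μ x| ≤ M) (a b : ℂ) {R : ℝ}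
    (hM1 : 1 ≤ M) (hR : 1 ≤ R) (n : ℕ) :
    ∀ x, |x| ≤ R →
      ‖(energyCoeff ε μ a b n).1 x‖ ≤
        (‖a‖ + ‖b‖ * (M * R)) * (M ^ 2 * R) ^ n / n.factorial * |x| ^ n ∧
      ‖(energyCoeff ε μ a b n).2 x‖ ≤
        (‖a‖ + ‖b‖ * (M * R)) * (M ^ 2 * R) ^ n / n.factorial * |x| ^ n := by
  have hMR : 1 ≤ M * R := one_le_mul_of_one_le_of_one_le hM1 hR
  set L := ‖a‖ + ‖b‖ * (M * R) with hL
  have hL0 : 0 ≤ L := by positivity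
  induction n with
  | zero =>
    intro x hx
    simp only [energyCoeff, pow_zero, Nat.factorial_zero, Nat.cast_one, div_one, mul_one]
    constructor
    · refine (norm_add_le _ _).trans (add_le_add le_rfl ?_)
      refine (norm_weightedPrimitive_le hμM (K := ‖b‖) (n := 0) (by simp)).trans ?_
      simp only [zero_add, pow_one, Nat.cast_zero, div_one]
      rw [mul_comm M, mul_assoc]
      gcongr
    · nlinarith [norm_nonneg a, norm_nonneg b]
  | succ n ih =>
    intro x hx
    set c := L * (M ^ 2 * R) ^ n / n.factorial with hc
    have hc0 : 0 ≤ c := by positivity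
    have hfac : L * (M ^ 2 * R) ^ (n + 1) / (n + 1).factorial = c * (M ^ 2 * R) / (n + 1) := by
      rw [hc, Nat.factorial_succ, pow_succ]
      push_cast
      field_simp
    have hq : ∀ t, |t| ≤ |x| → ‖(energyCoeff ε μ a b (n + 1)).2 t‖ ≤
        M * c / (n + 1) * |t| ^ (n + 1) := by
      intro t ht
      simp only [energyCoeff, norm_neg]
      refine (norm_weightedPrimitive_le hεM (K := c) (n := n)
        fun s hs => (ih s (hs.trans (ht.trans hx))).1).trans_eq ?_
      ring
    rw [hfac]
    constructor
    · refine (norm_weightedPrimitive_le hμM (f := (energyCoeff ε μ a b (n + 1)).2)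
        (n := n + 1) hq).trans ?_
      have h1 : M * (M * c / (n + 1)) * |x| ^ (n + 1 + 1) / ((n + 1 : ℕ) + 1) ≤
          M * (M * c / (n + 1)) * |x| ^ (n + 1 + 1) / 1 := by
        gcongr
        push_cast
        linarith [(Nat.cast_nonneg n : (0 : ℝ) ≤ n)]
      refine h1.trans ?_
      have h2 : M * (M * c / (n + 1)) * |x| ^ (n + 1 + 1) / 1 =
          M * (M * c / (n + 1)) * |x| ^ (n + 1) * |x| := by ring
      have h3 : c * (M ^ 2 * R) / (n + 1) * |x| ^ (n + 1) =
          M * (M * c / (n + 1)) * |x| ^ (n + 1) * R := by ring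
      rw [h2, h3]
      gcongr
    · refine (hq x le_rfl).trans ?_
      have : M * c / (n + 1) ≤ c * (M ^ 2 * R) / (n + 1) := by
        rw [mul_comm M c]
        gcongr
        nlinarith [mul_le_mul_of_nonneg_left hMR (by linarith : 0 ≤ M)]
      gcongr

theorem exists_summable_energyCoeff (hεM : ∀ x, |ε x| ≤ M) (hμM : ∀ x, |μ x| ≤ M) (a b : ℂ)
    (hM1 : 1 ≤ M) (R ρ : ℝ) :
    ∃ u : ℕ → ℝ, Summable u ∧ ∀ n (E : ℂ) x, ‖E‖ ≤ ρ → |x| ≤ R →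
      ‖E ^ n * (energyCoeff ε μ a b n).1 x‖ ≤ u n ∧
      ‖E ^ n * (energyCoeff ε μ a b n).2 x‖ ≤ u n := by
  set R' := max R 1
  have hR' : 1 ≤ R' := le_max_right _ _
  set L := ‖a‖ + ‖b‖ * (M * R') with hL
  refine ⟨fun n => L * ((ρ * (M ^ 2 * R') * R') ^ n / n.factorial),
    (Real.summable_pow_div_factorial _).mul_left L, fun n E x hE hx => ?_⟩
  have hx' : |x| ≤ R' := hx.trans (le_max_left _ _)
  obtain ⟨h1, h2⟩ := norm_energyCoeff_le hεM hμM a b hM1 hR' n x hx'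
  have hρ : 0 ≤ ρ := (norm_nonneg E).trans hE
  have key : ‖E‖ ^ n * (L * (M ^ 2 * R') ^ n / n.factorial * |x| ^ n) ≤
      L * ((ρ * (M ^ 2 * R') * R') ^ n / n.factorial) := by
    have e : L * ((ρ * (M ^ 2 * R') * R') ^ n / n.factorial) =
        ρ ^ n * (L * (M ^ 2 * R') ^ n / n.factorial * R' ^ n) := by
      rw [mul_pow, mul_pow]; ring
    rw [e]
    gcongr
  simp only [norm_mul, norm_pow]
  exact ⟨(mul_le_mul_of_nonneg_left h1 (by positivity)).trans key,
    (mul_le_mul_of_nonneg_left h2 (by positivity)).trans key⟩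

end EnergySeries

/-- Solutions with given data at the origin exist on the whole line and depend holomorphically on
the energy. -/
theorem IsMedium.exists_isFieldOn {ε μ : ℝ → ℝ} {M : ℝ} (hm : IsMedium ε μ M) (a b : ℂ) :
    ∃ Ψ Q : ℂ → ℝ → ℂ, (∀ E, IsFieldOn ε μ E univ (Ψ E) (Q E) ∧ Ψ E 0 = a ∧ Q E 0 = b) ∧
      ∀ x, Differentiable ℂ (fun E => Ψ E x) ∧ Differentiable ℂ (fun E => Q E x) := by
  obtain ⟨hε, hμ⟩ := hm.measurable
  -- The coefficient estimates require a bound that is at least 1.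
  have hεM : ∀ x, |ε x| ≤ max M 1 := fun x => by
    rw [abs_of_pos (hm.pos_left x)]; exact (hm.le_left x).trans (le_max_left _ _)
  have hμM : ∀ x, |μ x| ≤ max M 1 := fun x => by
    rw [abs_of_pos (hm.pos_right x)]; exact (hm.le_right x).trans (le_max_left _ _)
  have hcont := continuous_energyCoeff hε hμ hεM hμM a b
  have hbound := exists_summable_energyCoeff hεM hμM a b (le_max_right M 1)
  set c := energyCoeff ε μ a b with hc
  set Ψ : ℂ → ℝ → ℂ := fun E x => ∑' n, E ^ n * (c n).1 x with hΨ
  set Q : ℂ → ℝ → ℂ := fun E x => ∑' n, E ^ n * (c n).2 x with hQ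
  have hsum : ∀ E x, Summable (fun n => E ^ n * (c n).1 x) ∧
      Summable (fun n => E ^ n * (c n).2 x) := fun E x => by
    obtain ⟨u, hu, hb⟩ := hbound |x| ‖E‖
    exact ⟨.of_norm_bounded hu fun n => (hb n E x le_rfl le_rfl).1,
      .of_norm_bounded hu fun n => (hb n E x le_rfl le_rfl).2⟩
  have hcts : ∀ E, Continuous (Ψ E) ∧ Continuous (Q E) := fun E => by
    have hnhds : ∀ x : ℝ, Icc (-(|x| + 1)) (|x| + 1) ∈ 𝓝 x := fun x =>
      Icc_mem_nhds (by linarith [neg_abs_le x]) (by linarith [le_abs_self x])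
    constructor <;>
    · refine continuous_iff_continuousAt.2 fun x => ContinuousOn.continuousAt ?_ (hnhds x)
      obtain ⟨u, hu, hb⟩ := hbound (|x| + 1) ‖E‖
      first
      | exact continuousOn_tsum (fun n => (continuous_const.mul (hcont n).1).continuousOn) hu
          fun n y hy => (hb n E y le_rfl (abs_le.2 hy)).1
      | exact continuousOn_tsum (fun n => (continuous_const.mul (hcont n).2).continuousOn) hu
          fun n y hy => (hb n E y le_rfl (abs_le.2 hy)).2
  have hscale : ∀ (w : ℝ → ℝ) (z : ℂ) (f : ℝ → ℂ) x,
      weightedPrimitive w (fun t => z * f t) x = z * weightedPrimitive w f x := fun w z f x => by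
    simp only [weightedPrimitive, mul_left_comm _ z, intervalIntegral.integral_const_mul]
  have hΨeq : ∀ E x, Ψ E x = a + weightedPrimitive μ (Q E) x := fun E x => by
    obtain ⟨u, hu, hb⟩ := hbound |x| ‖E‖
    have h := hasSum_weightedPrimitive hμ hμM
      (F := fun n t => E ^ n * (c n).2 t) (fun n => continuous_const.mul (hcont n).2) (x := x)
      hu fun n t ht => (hb n E t le_rfl ht).2
    simp only [hscale] at h
    have h' := (hsum E x).1.hasSum
    -- Removing the zeroth terms lets the recursion of the coefficients match the two series, which
    -- is the integral form of the field equation.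
    rw [← hasSum_nat_add_iff' 1] at h h'
    have e : ∀ n, E ^ (n + 1) * (c (n + 1)).1 x =
      E ^ (n + 1) * weightedPrimitive μ (c (n + 1)).2 x := fun n => rfl
    simp only [e] at h'
    have := h'.unique h
    simp only [Finset.range_one, Finset.sum_singleton, pow_zero, one_mul] at this
    have e0 : (c 0).1 x = a + weightedPrimitive μ (c 0).2 x := rfl
    rw [e0] at this
    linear_combination this
  have hQeq : ∀ E x, Q E x = b - E * weightedPrimitive ε (Ψ E) x := fun E x => by
    obtain ⟨u, hu, hb⟩ := hbound |x| ‖E‖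
    have h := (hasSum_weightedPrimitive hε hεM
      (F := fun n t => E ^ n * (c n).1 t) (fun n => continuous_const.mul (hcont n).1) (x := x)
      hu fun n t ht => (hb n E t le_rfl ht).1).mul_left (-E)
    simp only [hscale] at h
    have h' := (hsum E x).2.hasSum
    rw [← hasSum_nat_add_iff' 1] at h'
    have e : ∀ n, E ^ (n + 1) * (c (n + 1)).2 x =
      -E * (E ^ n * weightedPrimitive ε (c n).1 x) := fun n => by
        have : (c (n + 1)).2 x = -weightedPrimitive ε (c n).1 x := rfl
        rw [this]; ring
    simp only [e] at h'
    have := h'.unique h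
    simp only [Finset.range_one, Finset.sum_singleton, pow_zero, one_mul] at this
    have e0 : (c 0).2 x = b := rfl
    rw [e0] at this
    linear_combination this
  refine ⟨Ψ, Q, fun E => ⟨⟨(hcts E).1.continuousOn, (hcts E).2.continuousOn, ?_, ?_⟩, ?_, ?_⟩,
    fun x => ?_⟩
  · intro x _ _ hx
    have h := (hasDerivAt_weightedPrimitive hμ hμM (hcts E).2 hx).const_add a
    exact h.congr_of_eventuallyEq (Eventually.of_forall (hΨeq E))
  · intro x _ hx _
    have h := ((hasDerivAt_weightedPrimitive hε hεM (hcts E).1 hx).const_mul E).const_sub b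
    refine (h.congr_of_eventuallyEq (Eventually.of_forall (hQeq E))).congr_deriv ?_
    ring
  · simp [hΨeq, weightedPrimitive]
  · simp [hQeq, weightedPrimitive]
  · constructor <;>
    · intro E
      obtain ⟨u, hu, hb⟩ := hbound |x| (‖E‖ + 1)
      have hE : Metric.ball 0 (‖E‖ + 1) ∈ 𝓝 E :=
        Metric.isOpen_ball.mem_nhds (by simp)
      refine DifferentiableOn.differentiableAt (s := Metric.ball 0 (‖E‖ + 1)) ?_ hE
      refine Complex.differentiableOn_tsum_of_summable_norm hu (fun n => ?_) Metric.isOpen_ball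
        fun n w hw => ?_
      · fun_prop
      · first
        | exact (hb n w x (by simpa using (mem_ball_zero_iff.1 hw).le) le_rfl).1
        | exact (hb n w x (by simpa using (mem_ball_zero_iff.1 hw).le) le_rfl).2

/-! ### Fundamental solutions and the transfer matrix of a period -/

/-- Monotonicity applied to `Re (conj (f b - f a) * f)` yields `‖f b - f a‖ ^ 2 ≤ 0`. -/
theorem IsMedium.eq_of_hasDerivAt_zero {ε μ : ℝ → ℝ} {M : ℝ} (hm : IsMedium ε μ M) {f : ℝ → ℂ}
    {a b : ℝ} (hab : a ≤ b) (hc : ContinuousOn f (Icc a b))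
    (hd : ∀ x ∈ Ioo a b, ContinuousAt ε x → ContinuousAt μ x → HasDerivAt f 0 x) :
    f b = f a := by
  have h : AntitoneOn (fun x => (conj (f b - f a) * f x).re) (Icc a b) := by
    refine hm.antitoneOn
      (Complex.continuous_re.comp_continuousOn (continuousOn_const.mul hc)) fun x hx h1 h2 => ?_
    refine ⟨_, HasFDerivAt.comp_hasDerivAt x Complex.reCLM.hasFDerivAt
      ((hd x hx h1 h2).const_mul (conj (f b - f a))), ?_⟩
    simp
  have h1 := h (left_mem_Icc.2 hab) (right_mem_Icc.2 hab) hab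
  simp only [map_sub, Complex.mul_re, Complex.sub_re, Complex.conj_re, Complex.sub_im,
    Complex.conj_im] at h1
  apply Complex.ext <;>
  nlinarith [sq_nonneg ((f b).re - (f a).re), sq_nonneg ((f b).im - (f a).im)]

namespace IsFieldOn

variable {ε μ : ℝ → ℝ} {E : ℂ} {s : Set ℝ} {ψ q ψ₁ q₁ ψ₂ q₂ : ℝ → ℂ} {M : ℝ}

/-- Every solution is the combination of two fundamental solutions given by its initial data. -/
theorem eq_fundamental (h : IsFieldOn ε μ E s ψ q) (hm : IsMedium ε μ M) {b : ℝ}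
    (hs : Icc 0 b ⊆ s) (h1 : IsFieldOn ε μ E univ ψ₁ q₁) (h2 : IsFieldOn ε μ E univ ψ₂ q₂)
    (e1 : ψ₁ 0 = 1) (e2 : q₁ 0 = 0) (e3 : ψ₂ 0 = 0) (e4 : q₂ 0 = 1) :
    ∀ x ∈ Icc 0 b, ψ x = ψ 0 * ψ₁ x + q 0 * ψ₂ x ∧ q x = ψ 0 * q₁ x + q 0 * q₂ x := by
  intro x hx
  have hd := ((h.mono hs).lincomb ((h1.lincomb h2 (ψ 0) (q 0)).mono (subset_univ _)) 1 (-1))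
  have := hd.eq_zero_of_left hm subset_rfl (by simp [e1, e3]) (by simp [e2, e4]) x hx
  simp only [one_mul] at this
  exact ⟨by linear_combination this.1, by linear_combination this.2⟩

theorem wronskian_eq (hm : IsMedium ε μ M) {a b : ℝ} (hab : a ≤ b)
    (h1 : IsFieldOn ε μ E (Icc a b) ψ₁ q₁) (h2 : IsFieldOn ε μ E (Icc a b) ψ₂ q₂) :
    ψ₁ b * q₂ b - q₁ b * ψ₂ b = ψ₁ a * q₂ a - q₁ a * ψ₂ a := by
  refine hm.eq_of_hasDerivAt_zero (f := fun x => ψ₁ x * q₂ x - q₁ x * ψ₂ x) hab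
    ((h1.1.mul h2.2).sub (h1.2.mul h2.1)) fun x hx c1 c2 => ?_
  have hx' : x ∈ interior (Icc a b) := by rwa [interior_Icc]
  refine (((h1.3 x hx' c1 c2).mul (h2.4 x hx' c1 c2)).sub
    ((h1.4 x hx' c1 c2).mul (h2.3 x hx' c1 c2))).congr_deriv ?_
  ring

end IsFieldOn

/-- `A, B, C, D` are the entries, as functions of the energy, of the transfer matrix over one
period of the periodic medium `(ε, μ)`. -/
structure IsMonodromy (ε μ : ℝ → ℝ) (A B C D : ℂ → ℂ) : Prop where
  differentiable₁ : Differentiable ℂ A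
  differentiable₂ : Differentiable ℂ B
  differentiable₃ : Differentiable ℂ C
  differentiable₄ : Differentiable ℂ D
  det_eq : ∀ E, A E * D E - B E * C E = 1
  real : ∀ E : ℝ, conj (A E) = A E ∧ conj (B E) = B E ∧ conj (C E) = C E ∧ conj (D E) = D E
  transfer : ∀ (E : ℂ) (s : Set ℝ) (ψ q : ℝ → ℂ), IsFieldOn ε μ E s ψ q →
    ∀ k : ℕ, Icc (k : ℝ) (k + 1) ⊆ s →
      ψ (k + 1) = A E * ψ k + B E * q k ∧ q (k + 1) = C E * ψ k + D E * q k

section Periodic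

variable {ε μ : ℝ → ℝ} {E : ℂ} {s : Set ℝ} {ψ q : ℝ → ℂ}

theorem IsFieldOn.shift_nat (h : IsFieldOn ε μ E s ψ q) (hε : Function.Periodic ε 1)
    (hμ : Function.Periodic μ 1) (k : ℕ) (hs : Icc (k : ℝ) (k + 1) ⊆ s) :
    IsFieldOn ε μ E (Icc 0 1) (fun x => ψ (x + k)) (fun x => q (x + k)) := by
  have h1 := (h.mono hs).shift k
  have e1 := hε.nat_mul k
  have e2 := hμ.nat_mul k
  simp only [mul_one] at e1 e2
  refine h1.congr_coeff ?_ (fun x _ => e1 x) (fun x _ => e2 x)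
  intro x hx
  exact ⟨by linarith [hx.1], by linarith [hx.2]⟩

theorem IsPeriodicCoeff.exists_isMonodromy (hε : IsPeriodicCoeff ε) (hμ : IsPeriodicCoeff μ) :
    ∃ A B C D, IsMonodromy ε μ A B C D := by
  obtain ⟨M, hm⟩ := hε.isMedium hμ
  obtain ⟨Ψ₁, Q₁, h1, d1⟩ := hm.exists_isFieldOn 1 0
  obtain ⟨Ψ₂, Q₂, h2, d2⟩ := hm.exists_isFieldOn 0 1
  have hfund : ∀ (E : ℂ) (s : Set ℝ) (ψ q : ℝ → ℂ), IsFieldOn ε μ E s ψ q → Icc 0 1 ⊆ s →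
      ψ 1 = ψ 0 * Ψ₁ E 1 + q 0 * Ψ₂ E 1 ∧ q 1 = ψ 0 * Q₁ E 1 + q 0 * Q₂ E 1 :=
    fun E s ψ q h hs => h.eq_fundamental hm hs (h1 E).1 (h2 E).1 (h1 E).2.1 (h1 E).2.2 (h2 E).2.1
      (h2 E).2.2 1 (right_mem_Icc.2 zero_le_one)
  refine ⟨fun E => Ψ₁ E 1, fun E => Ψ₂ E 1, fun E => Q₁ E 1, fun E => Q₂ E 1,
    (d1 1).1, (d2 1).1, (d1 1).2, (d2 1).2, fun E => ?_, fun E => ?_, ?_⟩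
  · have h := IsFieldOn.wronskian_eq hm zero_le_one ((h1 E).1.mono (subset_univ _))
      ((h2 E).1.mono (subset_univ _))
    simp only [(h1 E).2.1, (h1 E).2.2, (h2 E).2.1, (h2 E).2.2] at h
    linear_combination h
  · have c1 := (h1 E).1.conjugate
    have c2 := (h2 E).1.conjugate
    rw [Complex.conj_ofReal] at c1 c2
    have k1 := hfund _ _ _ _ c1 (subset_univ _)
    have k2 := hfund _ _ _ _ c2 (subset_univ _)
    simp only [(h1 E).2.1, (h1 E).2.2, (h2 E).2.1, (h2 E).2.2, map_one, map_zero, one_mul,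
      zero_mul, add_zero, zero_add] at k1 k2
    exact ⟨k1.1, k2.1, k1.2, k2.2⟩
  · intro E s ψ q h k hs
    have := hfund _ _ _ _ (h.shift_nat hε.periodic hμ.periodic k hs) subset_rfl
    simp only [zero_add, add_comm (1 : ℝ)] at this
    exact ⟨by rw [this.1]; ring, by rw [this.2]; ring⟩

/-- The field over one period controls the initial data. -/
theorem IsMedium.exists_le_integral_norm_sq {M : ℝ} (hm : IsMedium ε μ M) (E : ℂ) :
    ∃ c > 0, ∀ ψ q : ℝ → ℂ, IsFieldOn ε μ E (Icc 0 1) ψ q →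
      c * (‖ψ 0‖ ^ 2 + ‖q 0‖ ^ 2) ≤ ∫ x in (0 : ℝ)..1, ‖ψ x‖ ^ 2 := by
  obtain ⟨Ψ₁, Q₁, h1, -⟩ := hm.exists_isFieldOn 1 0
  obtain ⟨Ψ₂, Q₂, h2, -⟩ := hm.exists_isFieldOn 0 1
  have c1 : Continuous (Ψ₁ E) := continuousOn_univ.1 (h1 E).1.1
  have c2 : Continuous (Ψ₂ E) := continuousOn_univ.1 (h2 E).1.1
  -- The constant `c` is the minimum over unit data of the squared norm on one period; general data
  -- follow by scaling.
  set S : Set (ℂ × ℂ) := {v | ‖v.1‖ ^ 2 + ‖v.2‖ ^ 2 = 1} with hS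
  set F : ℂ × ℂ → ℝ := fun v => ∫ x in (0 : ℝ)..1, ‖v.1 * Ψ₁ E x + v.2 * Ψ₂ E x‖ ^ 2 with hF
  have hFc : Continuous F := by
    refine intervalIntegral.continuous_parametric_intervalIntegral_of_continuous' ?_ 0 1
    simp only [Function.uncurry_def]
    fun_prop
  have hSc : IsCompact S := by
    refine Metric.isCompact_of_isClosed_isBounded
      (isClosed_eq (by fun_prop) continuous_const) ?_
    refine (Metric.isBounded_closedBall (x := (0 : ℂ × ℂ)) (r := 1)).subset fun v hv => ?_
    rw [mem_closedBall_zero_iff, Prod.norm_def]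
    have hv' : ‖v.1‖ ^ 2 + ‖v.2‖ ^ 2 = 1 := hv
    refine max_le ?_ ?_ <;>
      nlinarith [sq_nonneg ‖v.1‖, sq_nonneg ‖v.2‖, norm_nonneg v.1, norm_nonneg v.2]
  have hSn : S.Nonempty := ⟨(1, 0), by simp [hS]⟩
  obtain ⟨v, hv, hmin⟩ := hSc.exists_isMinOn hSn hFc.continuousOn
  -- A zero minimum would be a field vanishing on the whole period; then its flux vanishes too,
  -- contradicting unit data.
  have hpos : 0 < F v := by
    by_contra hneg
    set ψ := fun x => v.1 * Ψ₁ E x + v.2 * Ψ₂ E x with hψ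
    have hfield := (h1 E).1.lincomb (h2 E).1 v.1 v.2
    have hcψ : Continuous fun x => ‖ψ x‖ ^ 2 := by fun_prop
    have hz : ∀ x ∈ Icc (0 : ℝ) 1, ψ x = 0 := by
      intro x hx
      by_contra hne
      exact hneg (intervalIntegral.integral_pos one_pos hcψ.continuousOn
        (fun _ _ => by positivity) ⟨x, hx, by positivity⟩)
    have hq := hfield.flux_eq_zero hm one_pos (subset_univ _) hz
    have z1 := hz 0 (left_mem_Icc.2 zero_le_one)
    have z2 := hq 0 (left_mem_Icc.2 zero_le_one)
    simp only [hψ, (h1 E).2.1, (h1 E).2.2, (h2 E).2.1, (h2 E).2.2, mul_one, mul_zero, add_zero,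
      zero_add] at z1 z2
    have hv' : ‖v.1‖ ^ 2 + ‖v.2‖ ^ 2 = 1 := hv
    simp [z1, z2] at hv'
  refine ⟨F v, hpos, fun ψ q h => ?_⟩
  have e : ∫ x in (0 : ℝ)..1, ‖ψ x‖ ^ 2 = F (ψ 0, q 0) := by
    refine intervalIntegral.integral_congr fun x hx => ?_
    rw [uIcc_of_le zero_le_one] at hx
    simp only
    rw [(h.eq_fundamental hm subset_rfl (h1 E).1 (h2 E).1 (h1 E).2.1 (h1 E).2.2 (h2 E).2.1
      (h2 E).2.2 x hx).1]
  rw [e]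
  set n := Real.sqrt (‖ψ 0‖ ^ 2 + ‖q 0‖ ^ 2) with hn
  have hn2 : n ^ 2 = ‖ψ 0‖ ^ 2 + ‖q 0‖ ^ 2 := Real.sq_sqrt (by positivity)
  by_cases hn0 : n = 0
  · rw [← hn2, hn0]
    simpa using intervalIntegral.integral_nonneg zero_le_one fun x _ => by positivity
  · have hn0' : 0 < n := lt_of_le_of_ne (Real.sqrt_nonneg _) (Ne.symm hn0)
    have hw : (ψ 0 / n, q 0 / n) ∈ S := by
      simp only [hS, mem_ofPred_eq, norm_div, Complex.norm_real, Real.norm_eq_abs, div_pow, sq_abs]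
      rw [← add_div, ← hn2, div_self (by positivity)]
    have hle : F v ≤ F (ψ 0 / n, q 0 / n) := hmin hw
    have hsc : F (ψ 0, q 0) = n ^ 2 * F (ψ 0 / n, q 0 / n) := by
      simp only [hF]
      rw [← intervalIntegral.integral_const_mul]
      refine intervalIntegral.integral_congr fun x _ => ?_
      have hnc : (n : ℂ) ≠ 0 := by exact_mod_cast hn0
      have : ψ 0 * Ψ₁ E x + q 0 * Ψ₂ E x =
          n * (ψ 0 / n * Ψ₁ E x + q 0 / n * Ψ₂ E x) := by field_simp
      rw [this, norm_mul, mul_pow, Complex.norm_real, Real.norm_eq_abs, sq_abs]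
    rw [hsc, ← hn2, mul_comm]
    exact mul_le_mul_of_nonneg_left hle (by positivity)

/-- The data at the period points of a square integrable solution tend to zero. -/
theorem IsFieldOn.tendsto_zero_of_integrableOn (hε : IsPeriodicCoeff ε) (hμ : IsPeriodicCoeff μ)
    (h : IsFieldOn ε μ E (Ici 0) ψ q) (hi : IntegrableOn (fun x => ‖ψ x‖ ^ 2) (Ioi 0)) :
    Tendsto (fun n : ℕ => ψ n) atTop (𝓝 0) ∧ Tendsto (fun n : ℕ => q n) atTop (𝓝 0) := by
  obtain ⟨M, hm⟩ := hε.isMedium hμ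
  obtain ⟨c, hc, hle⟩ := hm.exists_le_integral_norm_sq E
  -- The integrals over `[0, n]` converge, so the integral over a single period tends to zero and
  -- controls the data there.
  have ht := intervalIntegral_tendsto_integral_Ioi (0 : ℝ) hi
    (tendsto_natCast_atTop_atTop (R := ℝ))
  have ht1 := (ht.comp (tendsto_add_atTop_nat 1)).sub ht
  rw [sub_self] at ht1
  have hint : ∀ n : ℕ, ∫ x in (0 : ℝ)..1, ‖ψ (x + n)‖ ^ 2 =
      (∫ x in (0 : ℝ)..((n + 1 : ℕ) : ℝ), ‖ψ x‖ ^ 2) - ∫ x in (0 : ℝ)..(n : ℝ), ‖ψ x‖ ^ 2 := by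
    intro n
    have hii : ∀ m : ℕ, IntervalIntegrable (fun x => ‖ψ x‖ ^ 2) volume 0 (m : ℝ) := fun m =>
      (intervalIntegrable_iff_integrableOn_Ioc_of_le (Nat.cast_nonneg m)).2
        (hi.mono_set Ioc_subset_Ioi_self)
    rw [intervalIntegral.integral_interval_sub_left (hii _) (hii _),
      intervalIntegral.integral_comp_add_right (fun x => ‖ψ x‖ ^ 2)]
    push_cast
    rw [zero_add, add_comm (1 : ℝ)]
  have hb : ∀ n : ℕ, ‖ψ n‖ ^ 2 + ‖q n‖ ^ 2 ≤ c⁻¹ * ((∫ x in (0 : ℝ)..((n + 1 : ℕ) : ℝ), ‖ψ x‖ ^ 2)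
      - ∫ x in (0 : ℝ)..(n : ℝ), ‖ψ x‖ ^ 2) := by
    intro n
    have := hle _ _ (h.shift_nat hε.periodic hμ.periodic n
      fun x hx => (Nat.cast_nonneg n).trans hx.1)
    rw [hint] at this
    simp only [zero_add] at this
    rw [inv_mul_eq_div, le_div_iff₀ hc]
    linarith
  have hz : Tendsto (fun n : ℕ => ‖ψ n‖ ^ 2 + ‖q n‖ ^ 2) atTop (𝓝 0) := by
    refine squeeze_zero (fun n => by positivity) hb ?_
    simpa using ht1.const_mul c⁻¹
  have hsq : ∀ f : ℕ → ℂ, (∀ n, ‖f n‖ ^ 2 ≤ ‖ψ n‖ ^ 2 + ‖q n‖ ^ 2) → Tendsto f atTop (𝓝 0) := by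
    intro f hf
    have h1 : Tendsto (fun n => ‖f n‖ ^ 2) atTop (𝓝 0) :=
      squeeze_zero (fun n => by positivity) hf hz
    have h2 := h1.sqrt
    simp only [Real.sqrt_sq (norm_nonneg _), Real.sqrt_zero] at h2
    exact tendsto_zero_iff_norm_tendsto_zero.2 h2
  exact ⟨hsq _ fun n => by nlinarith [sq_nonneg ‖q n‖], hsq _ fun n => by nlinarith [sq_nonneg ‖ψ n‖]⟩

end Periodic

/-! ### Hyperbolicity and the outgoing condition after many periods -/

/-- A solution of a two-term recurrence with multipliers on the unit circle that tends to zero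
vanishes. -/
theorem eq_zero_of_recurrence_of_tendsto {t : ℝ} (ht : |t| ≤ 2) {a : ℕ → ℂ}
    (ha : ∀ n, a (n + 2) = t * a (n + 1) - a n) (h0 : Tendsto a atTop (𝓝 0)) : a 0 = 0 := by
  -- `I` is a conserved quadratic form of the recurrence, and for `|t| ≤ 2` it dominates `(‖a (n +
  -- 1)‖ - ‖a n‖) ^ 2`. Its limit is zero, so `I` vanishes and `‖a n‖` is constant.
  set I : ℕ → ℝ := fun n => ‖a (n + 1)‖ ^ 2 + ‖a n‖ ^ 2 - t * inner ℝ (a (n + 1)) (a n) with hI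
  have h1 : Tendsto (fun n => a (n + 1)) atTop (𝓝 0) := h0.comp (tendsto_add_atTop_nat 1)
  have hconst : ∀ n, I n = I 0 := by
    intro n
    induction n with
    | zero => rfl
    | succ n ih =>
      rw [← ih]
      simp only [hI, ha, Complex.inner, ← Complex.normSq_eq_norm_sq, Complex.normSq_apply,
        Complex.mul_re, Complex.mul_im, Complex.sub_re, Complex.sub_im, Complex.conj_re,
        Complex.conj_im, Complex.ofReal_re, Complex.ofReal_im]
      ring
  have hlim : Tendsto I atTop (𝓝 0) := by
    have := ((h1.norm.pow 2).add (h0.norm.pow 2)).sub ((h1.inner h0).const_mul t)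
    rw [norm_zero, inner_zero_left] at this
    simpa only [hI, mul_zero, sub_zero, ne_eq, OfNat.ofNat_ne_zero, not_false_eq_true, zero_pow,
      add_zero] using this
  have hI0 : ∀ n, I n = 0 := by
    have : I 0 = 0 := tendsto_nhds_unique
      (tendsto_const_nhds.congr fun n => (hconst n).symm) hlim
    intro n
    rw [hconst, this]
  have hstep : ∀ n, ‖a (n + 1)‖ = ‖a n‖ := by
    intro n
    have e := hI0 n
    simp only [hI] at e
    have h2 := abs_real_inner_le_norm (a (n + 1)) (a n)
    have h3 : t * inner ℝ (a (n + 1)) (a n) ≤ 2 * (‖a (n + 1)‖ * ‖a n‖) :=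
      (le_abs_self _).trans (by rw [abs_mul]; gcongr)
    nlinarith [sq_nonneg (‖a (n + 1)‖ - ‖a n‖)]
  have hn : ∀ n, ‖a n‖ = ‖a 0‖ := by
    intro n
    induction n with
    | zero => rfl
    | succ n ih => rw [hstep, ih]
  have := tendsto_nhds_unique (tendsto_const_nhds.congr fun n => (hn n).symm) h0.norm
  simpa using this

/-- This is the spectral decomposition `(κ - l) T ^ n = κ ^ n (T - l) + l ^ n (κ - T)` of a matrix
`T` with eigenvalues `l` and `κ`, multiplied by `l ^ n` with `l * κ = 1`. -/
theorem transfer_pow_formula {A B C D l κ : ℂ} (h1 : l * κ = 1) (h2 : A + D = l + κ)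
    (h3 : A * D - B * C = 1) {a b : ℕ → ℂ} {N : ℕ}
    (hab : ∀ k < N, a (k + 1) = A * a k + B * b k ∧ b (k + 1) = C * a k + D * b k) :
    ∀ n ≤ N, (κ - l) * (l ^ n * a n) = (A - l) * a 0 + B * b 0 +
        l ^ (2 * n) * ((κ - A) * a 0 - B * b 0) ∧
      (κ - l) * (l ^ n * b n) = C * a 0 + (D - l) * b 0 +
        l ^ (2 * n) * (-C * a 0 + (κ - D) * b 0) := by
  intro n
  induction n with
  | zero => intro _; constructor <;> simp <;> ring
  | succ n ih =>
    intro hn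
    obtain ⟨ia, ib⟩ := ih (by omega)
    obtain ⟨ra, rb⟩ := hab n (by omega)
    have e : l ^ (2 * (n + 1)) = l ^ (2 * n) * l ^ 2 := by ring
    rw [ra, rb, e, pow_succ]
    constructor
    · linear_combination l * A * ia + l * B * ib + b 0 * B * (l * h2 + h1) +
        a 0 * (A * (l * h2 + h1) - l * h3) +
        l * l ^ (2 * n) * (a 0 * (h3 - A * h2 - h1) - b 0 * B * h2)
    · linear_combination l * C * ia + l * D * ib + a 0 * C * (l * h2 + h1) +
        b 0 * (D * (l * h2 + h1) - l * h3) +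
        l * l ^ (2 * n) * (b 0 * (h3 - D * h2 - h1) - a 0 * C * h2)

/-- Choice of the multiplier inside the unit circle, holomorphic near a hyperbolic point. -/
theorem exists_multiplier {t : ℂ → ℂ} (ht : Differentiable ℂ t) {z₀ : ℂ} {τ : ℝ}
    (hz₀ : t z₀ = τ) (hτ : 2 < |τ|) :
    ∃ l κ : ℂ → ℂ, (∀ᶠ z in 𝓝 z₀, DifferentiableAt ℂ l z ∧ DifferentiableAt ℂ κ z ∧ κ z ≠ l z ∧
      ‖l z‖ ≤ (‖l z₀‖ + 1) / 2) ∧ (∀ z, l z + κ z = t z) ∧ (∀ z, l z * κ z = 1) ∧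
      ‖l z₀‖ < 1 ∧ conj (l z₀) = l z₀ := by
  -- `σ` is the sign of `τ`. With it the root `s` has the sign of the trace at `z₀`, so that `(t -
  -- s) / 2` is the eigenvalue inside the unit circle.
  obtain ⟨σ, hσ, hστ⟩ : ∃ σ : ℝ, σ ^ 2 = 1 ∧ σ * τ = |τ| := by
    rcases le_total 0 τ with h | h
    · exact ⟨1, by norm_num, by rw [abs_of_nonneg h, one_mul]⟩
    · exact ⟨-1, by norm_num, by rw [abs_of_nonpos h]; ring⟩
  have hσc : (σ : ℂ) ^ 2 = 1 := by exact_mod_cast hσ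
  have hσ0 : (σ : ℂ) ≠ 0 := fun h => by simp [h] at hσc
  set s : ℂ → ℂ := fun z => σ * (t z ^ 2 - 4) ^ (1 / 2 : ℂ) with hs
  have hs2 : ∀ z, s z ^ 2 = t z ^ 2 - 4 := fun z => by
    simp only [hs]
    rw [mul_pow, hσc, one_mul, ← Complex.cpow_nat_mul]
    norm_num
  have hpos : 0 < τ ^ 2 - 4 := by nlinarith [sq_abs τ]
  have hr := Real.sqrt_pos.2 hpos
  have hr2 := Real.sq_sqrt hpos.le
  have hs0 : s z₀ = σ * Real.sqrt (τ ^ 2 - 4) := by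
    simp only [hs, hz₀]
    congr 1
    rw [Real.sqrt_eq_rpow, Complex.ofReal_cpow hpos.le]
    push_cast
    rfl
  have hslit : ∀ᶠ z in 𝓝 z₀, t z ^ 2 - 4 ∈ Complex.slitPlane := by
    have hc : ContinuousAt (fun z => t z ^ 2 - 4) z₀ :=
      ((ht.continuous.pow 2).sub continuous_const).continuousAt
    refine hc.eventually_mem (Complex.isOpen_slitPlane.mem_nhds ?_)
    rw [hz₀]
    refine Or.inl ?_
    have : ((τ : ℂ) ^ 2 - 4).re = τ ^ 2 - 4 := by norm_cast
    rwa [this]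
  have hsd : ∀ᶠ z in 𝓝 z₀, DifferentiableAt ℂ s z ∧ s z ≠ 0 := by
    filter_upwards [hslit] with z hz
    constructor
    · exact ((((ht z).pow 2).sub_const 4).cpow_const hz).const_mul _
    · intro h0
      have := hs2 z
      rw [h0] at this
      exact Complex.slitPlane_ne_zero hz (by rw [← this]; ring)
  have hl0 : (t z₀ - s z₀) / 2 = ((σ * (|τ| - Real.sqrt (τ ^ 2 - 4)) / 2 : ℝ) : ℂ) := by
    rw [hz₀, hs0]
    have : (τ : ℂ) = σ * |τ| := by
      rw [← hστ]
      push_cast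
      linear_combination (-(τ : ℂ)) * hσc
    rw [this]
    push_cast
    ring
  have hlt : ‖(t z₀ - s z₀) / 2‖ < 1 := by
    rw [hl0, Complex.norm_real, Real.norm_eq_abs]
    have hσ1 : |σ| = 1 := by
      have : |σ| ^ 2 = 1 := by rw [sq_abs, hσ]
      nlinarith [abs_nonneg σ]
    rw [abs_div, abs_mul, hσ1, one_mul, abs_two, div_lt_one two_pos, abs_lt]
    have hab := sq_abs τ
    constructor <;> nlinarith
  refine ⟨fun z => (t z - s z) / 2, fun z => (t z + s z) / 2, ?_, fun z => by ring, fun z => ?_,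
    hlt, ?_⟩
  · have hcont : ContinuousAt (fun z => ‖(t z - s z) / 2‖) z₀ :=
      (((ht z₀).sub hsd.self_of_nhds.1).div_const 2).continuousAt.norm
    filter_upwards [hsd, hcont.eventually_lt continuousAt_const
      (show ‖(t z₀ - s z₀) / 2‖ < (‖(t z₀ - s z₀) / 2‖ + 1) / 2 by linarith)] with z hz hz'
    refine ⟨((ht z).sub hz.1).div_const 2, ((ht z).add hz.1).div_const 2, fun h => hz.2 ?_, hz'.le⟩
    linear_combination h
  · linear_combination (-1 / 4) * hs2 z
  · simp only [hl0, Complex.conj_ofReal]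

/-- Near an energy at which a half-line periodic medium has a nonzero square integrable solution,
the outgoing condition at the `n`-th period is a linear condition on the initial data that
converges geometrically to the condition of decay. -/
theorem exists_outgoing_asymptotics {ε μ : ℝ → ℝ} (hε : IsPeriodicCoeff ε)
    (hμ : IsPeriodicCoeff μ) {ω₀ : ℝ} (hω₀ : 0 < ω₀) {ψ₀ q₀ : ℝ → ℂ}
    (hf : IsFieldOn ε μ ((ω₀ : ℂ) ^ 2) (Ici 0) ψ₀ q₀)
    (hi : IntegrableOn (fun x => ‖ψ₀ x‖ ^ 2) (Ioi 0)) (hne : ψ₀ 0 ≠ 0 ∨ q₀ 0 ≠ 0) :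
    ∃ θ : ℝ, 0 < θ ∧ θ < 1 ∧ ∃ l g₁ g₂ h₁ h₂ : ℂ → ℂ,
      (∀ᶠ ω in 𝓝 (ω₀ : ℂ),
        (DifferentiableAt ℂ l ω ∧ DifferentiableAt ℂ g₁ ω ∧ DifferentiableAt ℂ g₂ ω ∧
          DifferentiableAt ℂ h₁ ω ∧ DifferentiableAt ℂ h₂ ω) ∧
        l ω ≠ 0 ∧ ‖l ω‖ ≤ θ ∧
        (∀ (n : ℕ) (ψ q : ℝ → ℂ), IsFieldOn ε μ (ω ^ 2) (Icc 0 n) ψ q →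
          l ω ^ n * (q n - Complex.I * ω * ψ n) =
            (g₁ ω + l ω ^ (2 * n) * h₁ ω) * ψ 0 + (g₂ ω + l ω ^ (2 * n) * h₂ ω) * q 0) ∧
        ∀ ψ q : ℝ → ℂ, IsFieldOn ε μ (ω ^ 2) (Ici 0) ψ q → g₁ ω * ψ 0 + g₂ ω * q 0 = 0 →
          Tendsto (fun n : ℕ => ψ n) atTop (𝓝 0) ∧ Tendsto (fun n : ℕ => q n) atTop (𝓝 0)) ∧
      g₁ ω₀ * ψ₀ 0 + g₂ ω₀ * q₀ 0 = 0 := by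
  obtain ⟨A, B, C, D, hM⟩ := hε.exists_isMonodromy hμ
  obtain ⟨lim₁, lim₂⟩ := hf.tendsto_zero_of_integrableOn hε hμ hi
  have htr : ∀ k : ℕ, ψ₀ (k + 1 : ℕ) = A (ω₀ ^ 2) * ψ₀ k + B (ω₀ ^ 2) * q₀ k ∧
      q₀ (k + 1 : ℕ) = C (ω₀ ^ 2) * ψ₀ k + D (ω₀ ^ 2) * q₀ k := fun k => by
    push_cast
    exact hM.transfer _ _ _ _ hf k fun x hx => (Nat.cast_nonneg k).trans hx.1
  have hdet := hM.det_eq (ω₀ ^ 2)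
  have hreal := hM.real (ω₀ ^ 2)
  push_cast at hreal
  obtain ⟨rA, rB, rC, rD⟩ := hreal
  obtain ⟨τ, hτ⟩ : ∃ τ : ℝ, A (ω₀ ^ 2) + D (ω₀ ^ 2) = τ := by
    obtain ⟨x, hx⟩ := Complex.conj_eq_iff_real.1 rA
    obtain ⟨y, hy⟩ := Complex.conj_eq_iff_real.1 rD
    exact ⟨x + y, by rw [hx, hy]; push_cast; rfl⟩
  have hτ2 : 2 < |τ| := by
    by_contra hle
    rw [not_lt] at hle
    have r₁ : ∀ n : ℕ, ψ₀ (n + 2 : ℕ) = τ * ψ₀ (n + 1 : ℕ) - ψ₀ n := fun n => by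
      rw [(htr (n + 1)).1, (htr n).1, (htr n).2, ← hτ]
      linear_combination -ψ₀ n * hdet
    have r₂ : ∀ n : ℕ, q₀ (n + 2 : ℕ) = τ * q₀ (n + 1 : ℕ) - q₀ n := fun n => by
      rw [(htr (n + 1)).2, (htr n).1, (htr n).2, ← hτ]
      linear_combination -q₀ n * hdet
    have z₁ := eq_zero_of_recurrence_of_tendsto hle r₁ lim₁
    have z₂ := eq_zero_of_recurrence_of_tendsto hle r₂ lim₂
    simp only [Nat.cast_zero] at z₁ z₂
    simp [z₁, z₂] at hne
  obtain ⟨l, κ, hev, hadd, hmul, hl1, hlreal⟩ := exists_multiplier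
    (hM.differentiable₁.add hM.differentiable₄) (z₀ := (ω₀ : ℂ) ^ 2) hτ hτ2
  have hl0 : ∀ z, l z ≠ 0 := fun z h => by simpa [h] using hmul z
  -- The midpoint between `‖l‖` at `ω₀` and 1 leaves room for a uniform bound near `ω₀`.
  set θ := (‖l (ω₀ ^ 2)‖ + 1) / 2 with hθ
  have hsq : ContinuousAt (fun ω : ℂ => ω ^ 2) ω₀ := (continuous_pow 2).continuousAt
  set I := Complex.I with hI
  -- `G` is the row `(-iω, 1)` of the outgoing condition times `T - l`, and `H` the same row times
  -- `κ - T`.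
  set G₁ : ℂ → ℂ := fun ω => -I * ω * (A (ω ^ 2) - l (ω ^ 2)) + C (ω ^ 2) with hG₁
  set G₂ : ℂ → ℂ := fun ω => -I * ω * B (ω ^ 2) + (D (ω ^ 2) - l (ω ^ 2)) with hG₂
  set H₁ : ℂ → ℂ := fun ω => -I * ω * (κ (ω ^ 2) - A (ω ^ 2)) - C (ω ^ 2) with hH₁
  set H₂ : ℂ → ℂ := fun ω => I * ω * B (ω ^ 2) + (κ (ω ^ 2) - D (ω ^ 2)) with hH₂
  have formula := fun (ω : ℂ) (a b : ℕ → ℂ) (N : ℕ) =>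
    transfer_pow_formula (a := a) (b := b) (N := N) (hmul (ω ^ 2)) (hadd (ω ^ 2)).symm
      (hM.det_eq (ω ^ 2))
  -- At the real point `ω₀` the matrix and `l` are real, so `G = 0` separates into real and
  -- imaginary parts. These give `A = D = l` and `B = 0`, hence determinant `l ^ 2`, which has
  -- modulus below 1.
  have hGne : G₁ ω₀ ≠ 0 ∨ G₂ ω₀ ≠ 0 := by
    by_contra hcon
    push Not at hcon
    obtain ⟨c₁, c₂⟩ := hcon
    have d₁ := congrArg conj c₁
    have d₂ := congrArg conj c₂
    simp only [hG₁, hG₂, map_add, map_mul, map_neg, map_sub, hI, Complex.conj_I,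
      Complex.conj_ofReal, rA, rB, rC, rD, hlreal, map_zero] at c₁ c₂ d₁ d₂
    have hIω : Complex.I * (ω₀ : ℂ) ≠ 0 :=
      mul_ne_zero Complex.I_ne_zero (by exact_mod_cast hω₀.ne')
    have eA : A (ω₀ ^ 2) - l (ω₀ ^ 2) = 0 := by
      refine (mul_eq_zero.1 ?_).resolve_left hIω
      linear_combination (d₁ - c₁) / 2
    have eB : B (ω₀ ^ 2) = 0 := by
      refine (mul_eq_zero.1 ?_).resolve_left hIω
      linear_combination (d₂ - c₂) / 2
    have eD : D (ω₀ ^ 2) - l (ω₀ ^ 2) = 0 := by linear_combination (d₂ + c₂) / 2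
    rw [eB, sub_eq_zero.1 eA, sub_eq_zero.1 eD] at hdet
    have hn := congrArg norm hdet
    simp only [zero_mul, sub_zero, norm_mul, norm_one] at hn
    nlinarith [norm_nonneg (l (ω₀ ^ 2))]
  have dsq : ∀ (f : ℂ → ℂ) (ω : ℂ), DifferentiableAt ℂ f (ω ^ 2) →
      DifferentiableAt ℂ (fun ω => f (ω ^ 2)) ω := fun f ω h =>
    DifferentiableAt.comp ω (f := fun ω : ℂ => ω ^ 2) h (by fun_prop)
  have hdiff : ∀ᶠ ω in 𝓝 (ω₀ : ℂ), DifferentiableAt ℂ G₁ ω ∧ DifferentiableAt ℂ G₂ ω ∧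
      DifferentiableAt ℂ H₁ ω ∧ DifferentiableAt ℂ H₂ ω := by
    filter_upwards [hsq.eventually hev] with ω hω
    have dl := dsq l ω hω.1
    have dκ := dsq κ ω hω.2.1
    have dA := dsq A ω (hM.differentiable₁ _)
    have dB := dsq B ω (hM.differentiable₂ _)
    have dC := dsq C ω (hM.differentiable₃ _)
    have dD := dsq D ω (hM.differentiable₄ _)
    have dI : ∀ c : ℂ, DifferentiableAt ℂ (fun ω : ℂ => c * ω) ω := fun c =>
      differentiableAt_id.const_mul c
    exact ⟨((dI _).mul (dA.sub dl)).add dC, ((dI _).mul dB).add (dD.sub dl),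
      ((dI _).mul (dκ.sub dA)).sub dC, ((dI _).mul dB).add (dκ.sub dD)⟩
  have hGev : ∀ᶠ ω in 𝓝 (ω₀ : ℂ), G₁ ω ≠ 0 ∨ G₂ ω ≠ 0 := by
    rcases hGne with h | h
    · exact (hdiff.self_of_nhds.1.continuousAt.eventually_ne h).mono fun _ => Or.inl
    · exact (hdiff.self_of_nhds.2.1.continuousAt.eventually_ne h).mono fun _ => Or.inr
  refine ⟨θ, by positivity, by linarith, fun ω => l (ω ^ 2),
    fun ω => G₁ ω / (κ (ω ^ 2) - l (ω ^ 2)), fun ω => G₂ ω / (κ (ω ^ 2) - l (ω ^ 2)),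
    fun ω => H₁ ω / (κ (ω ^ 2) - l (ω ^ 2)), fun ω => H₂ ω / (κ (ω ^ 2) - l (ω ^ 2)), ?_, ?_⟩
  · filter_upwards [hsq.eventually hev, hdiff, hGev] with ω hω hd hG
    have dl := dsq l ω hω.1
    have dκ := dsq κ ω hω.2.1
    have hs : κ (ω ^ 2) - l (ω ^ 2) ≠ 0 := sub_ne_zero.2 hω.2.2.1
    refine ⟨⟨dl, hd.1.div (dκ.sub dl) hs, hd.2.1.div (dκ.sub dl) hs,
      hd.2.2.1.div (dκ.sub dl) hs, hd.2.2.2.div (dκ.sub dl) hs⟩, hl0 _, hω.2.2.2, ?_, ?_⟩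
    · intro n ψ q h
      have hrec : ∀ k < n, ψ (k + 1 : ℕ) = A (ω ^ 2) * ψ k + B (ω ^ 2) * q k ∧
          q (k + 1 : ℕ) = C (ω ^ 2) * ψ k + D (ω ^ 2) * q k := fun k hk => by
        push_cast
        refine hM.transfer _ _ _ _ h k fun x hx => ⟨(Nat.cast_nonneg k).trans hx.1, hx.2.trans ?_⟩
        exact_mod_cast hk
      obtain ⟨f₁, f₂⟩ := formula ω (fun k => ψ k) (fun k => q k) n hrec n le_rfl
      simp only [Nat.cast_zero] at f₁ f₂
      simp only [hG₁, hG₂, hH₁, hH₂]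
      field_simp
      linear_combination f₂ - I * ω * f₁
    · intro ψ q h h0
      have hrec : ∀ k : ℕ, ψ (k + 1 : ℕ) = A (ω ^ 2) * ψ k + B (ω ^ 2) * q k ∧
          q (k + 1 : ℕ) = C (ω ^ 2) * ψ k + D (ω ^ 2) * q k := fun k => by
        push_cast
        exact hM.transfer _ _ _ _ h k fun x hx => (Nat.cast_nonneg k).trans hx.1
      have f := fun n : ℕ => formula ω (fun k => ψ k) (fun k => q k) n
        (fun k _ => hrec k) n le_rfl
      simp only [Nat.cast_zero] at f
      set x₁ := (A (ω ^ 2) - l (ω ^ 2)) * ψ 0 + B (ω ^ 2) * q 0 with hx₁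
      set x₂ := C (ω ^ 2) * ψ 0 + (D (ω ^ 2) - l (ω ^ 2)) * q 0 with hx₂
      have e0 : x₂ - I * ω * x₁ = 0 := by
        have : (κ (ω ^ 2) - l (ω ^ 2)) * (G₁ ω / (κ (ω ^ 2) - l (ω ^ 2)) * ψ 0 +
          G₂ ω / (κ (ω ^ 2) - l (ω ^ 2)) * q 0) = G₁ ω * ψ 0 + G₂ ω * q 0 := by field_simp
        rw [h0, mul_zero] at this
        simp only [hG₁, hG₂] at this
        rw [hx₁, hx₂]
        linear_combination -this
      have hdetl : (A (ω ^ 2) - l (ω ^ 2)) * (D (ω ^ 2) - l (ω ^ 2)) - B (ω ^ 2) * C (ω ^ 2) = 0 := by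
        have h' : l (ω ^ 2) + κ (ω ^ 2) = A (ω ^ 2) + D (ω ^ 2) := hadd (ω ^ 2)
        linear_combination hM.det_eq (ω ^ 2) - hmul (ω ^ 2) + l (ω ^ 2) * h'
      -- The vector `(x₁, x₂)` is `(T - l)` applied to the data. Since `T - l` is singular and `x₂ =
      -- iω x₁`, both entries of `G` annihilate `x₁`; as `G ≠ 0`, the growing component vanishes.
      have k₁ : G₁ ω * x₁ = 0 := by
        simp only [hG₁]
        linear_combination (A (ω ^ 2) - l (ω ^ 2)) * e0 - q 0 * hdetl
      have k₂ : G₂ ω * x₁ = 0 := by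
        simp only [hG₂]
        linear_combination B (ω ^ 2) * e0 + ψ 0 * hdetl
      have z₁ : x₁ = 0 := by
        rcases hG with h' | h'
        · exact (mul_eq_zero.1 k₁).resolve_left h'
        · exact (mul_eq_zero.1 k₂).resolve_left h'
      have z₂ : x₂ = 0 := by rw [z₁] at e0; simpa using e0
      have hlim : ∀ c : ℂ, Tendsto (fun n : ℕ => l (ω ^ 2) ^ n * (c / (κ (ω ^ 2) - l (ω ^ 2))))
          atTop (𝓝 0) := fun c => by
        have := (tendsto_pow_atTop_nhds_zero_of_norm_lt_one
          (hω.2.2.2.trans_lt (by linarith : θ < 1))).mul_const (c / (κ (ω ^ 2) - l (ω ^ 2)))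
        simpa using this
      have hcancel : ∀ (n : ℕ) (u c : ℂ), (κ (ω ^ 2) - l (ω ^ 2)) * (l (ω ^ 2) ^ n * u) =
          0 + l (ω ^ 2) ^ (2 * n) * c → l (ω ^ 2) ^ n * (c / (κ (ω ^ 2) - l (ω ^ 2))) = u := by
        intro n u c huc
        have hln : l (ω ^ 2) ^ n ≠ 0 := pow_ne_zero _ (hl0 _)
        have e : l (ω ^ 2) ^ (2 * n) = l (ω ^ 2) ^ n * l (ω ^ 2) ^ n := by ring
        rw [e] at huc
        field_simp
        apply mul_left_cancel₀ hln
        linear_combination -huc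
      rw [z₁, z₂] at f
      exact ⟨(hlim _).congr fun n => hcancel n _ _ (f n).1,
        (hlim _).congr fun n => hcancel n _ _ (f n).2⟩
  · have f := fun n : ℕ => formula ω₀ (fun k => ψ₀ k) (fun k => q₀ k) n
      (fun k _ => htr k) n le_rfl
    simp only [Nat.cast_zero] at f
    have hpow : Tendsto (fun n : ℕ => l (ω₀ ^ 2) ^ n) atTop (𝓝 0) :=
      tendsto_pow_atTop_nhds_zero_of_norm_lt_one hl1
    have hpow2 : Tendsto (fun n : ℕ => l (ω₀ ^ 2) ^ (2 * n)) atTop (𝓝 0) := by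
      simpa [two_mul, pow_add] using hpow.mul hpow
    -- Both `l ^ n * u n` and `l ^ (2 * n)` tend to zero, which leaves the constant term.
    have hz : ∀ (u : ℕ → ℂ) (x y : ℂ), Tendsto u atTop (𝓝 0) →
        (∀ n, (κ (ω₀ ^ 2) - l (ω₀ ^ 2)) * (l (ω₀ ^ 2) ^ n * u n) = x + l (ω₀ ^ 2) ^ (2 * n) * y) →
        x = 0 := by
      intro u x y hu h
      have h1 := (hpow.mul hu).const_mul (κ (ω₀ ^ 2) - l (ω₀ ^ 2))
      have h2 := (hpow2.mul_const y).const_add x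
      have := tendsto_nhds_unique (h1.congr h) h2
      simpa using this.symm
    have z₁ := hz _ _ _ lim₁ fun n => (f n).1
    have z₂ := hz _ _ _ lim₂ fun n => (f n).2
    simp only [hG₁, hG₂]
    rw [div_mul_eq_mul_div, div_mul_eq_mul_div, ← add_div, div_eq_zero_iff]
    left
    linear_combination z₂ - I * ω₀ * z₁

/-! ### Zeros of perturbed holomorphic functions -/

theorem AnalyticAt.exists_le_norm {F : ℂ → ℂ} {z₀ : ℂ} (hF : AnalyticAt ℂ F z₀) (h0 : F z₀ = 0)
    (hne : ¬∀ᶠ z in 𝓝 z₀, F z = 0) :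
    ∃ k : ℕ, k ≠ 0 ∧ ∃ c > 0, ∀ᶠ z in 𝓝 z₀, c * ‖z - z₀‖ ^ k ≤ ‖F z‖ := by
  obtain ⟨k, g, hg, hg0, hFg⟩ := hF.exists_eventuallyEq_pow_smul_nonzero_iff.2 hne
  refine ⟨k, ?_, ‖g z₀‖ / 2, by positivity, ?_⟩
  · rintro rfl
    have := hFg.self_of_nhds
    simp [h0] at this
    exact hg0 this.symm
  · have hlt : ‖g z₀‖ / 2 < ‖g z₀‖ := half_lt_self (by positivity)
    filter_upwards [hFg, continuousAt_const.eventually_lt hg.continuousAt.norm hlt] with z hz hz'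
    rw [hz, norm_smul, norm_pow, mul_comm]
    gcongr

/-- Without a zero, `1 / D` would be holomorphic on the disc and larger at the centre than its bound
on the circle, against the maximum principle. This replaces Rouché's theorem. -/
theorem exists_zero_of_norm_lt_sphere {D : ℂ → ℂ} {z₀ : ℂ} {r R m : ℝ} (hr : 0 < r) (hrR : r < R)
    (hD : DifferentiableOn ℂ D (Metric.ball z₀ R)) (hs : ∀ z ∈ Metric.sphere z₀ r, m < ‖D z‖)
    (hz₀ : ‖D z₀‖ < m) : ∃ z ∈ Metric.ball z₀ r, D z = 0 := by
  by_contra hcon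
  push Not at hcon
  have hm : 0 < m := (norm_nonneg _).trans_lt hz₀
  have hsub : Metric.closedBall z₀ r ⊆ Metric.ball z₀ R := Metric.closedBall_subset_ball hrR
  have hne : ∀ z ∈ Metric.closedBall z₀ r, D z ≠ 0 := by
    intro z hz
    rcases (Metric.mem_closedBall.1 hz).lt_or_eq with h | h
    · exact hcon z h
    · exact norm_pos_iff.1 (hm.trans (hs z h))
  have hd : DiffContOnCl ℂ (fun z => (D z)⁻¹) (Metric.ball z₀ r) := by
    apply DifferentiableOn.diffContOnCl
    rw [closure_ball z₀ hr.ne']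
    exact (hD.mono hsub).inv hne
  have h := Complex.norm_le_of_forall_mem_frontier_norm_le Metric.isBounded_ball hd (C := m⁻¹)
    (fun z hz => by
      rw [frontier_ball z₀ hr.ne'] at hz
      rw [norm_inv]
      exact inv_anti₀ hm (hs z hz).le) (subset_closure (Metric.mem_ball_self hr))
  rw [norm_inv] at h
  have hpos : 0 < ‖D z₀‖ := norm_pos_iff.2 (hne z₀ (Metric.mem_closedBall_self hr.le))
  exact absurd ((inv_le_inv₀ hpos hm).1 h) (not_le.2 hz₀)

/-- Zeros of geometrically small holomorphic perturbations of a function with an isolated zero. -/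
theorem AnalyticAt.exists_zeros_of_perturbation {F : ℂ → ℂ} {z₀ : ℂ} (hF : AnalyticAt ℂ F z₀)
    (h0 : F z₀ = 0) (hne : ¬∀ᶠ z in 𝓝 z₀, F z = 0) {θ K R : ℝ} (hθ : 0 < θ) (hθ1 : θ < 1)
    (hK : 0 < K) (hR : 0 < R) :
    ∃ δ > 0, δ < R ∧ ∃ C > 0, ∃ α > 0, ∃ N₀ : ℕ, ∀ N ≥ N₀, ∀ D : ℂ → ℂ,
      DifferentiableOn ℂ D (Metric.ball z₀ R) →
      (∀ z ∈ Metric.ball z₀ R, ‖D z - F z‖ ≤ K * θ ^ (2 * N)) →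
      (∃ z ∈ Metric.ball z₀ δ, D z = 0) ∧
        ∀ z ∈ Metric.ball z₀ δ, D z = 0 → ‖z - z₀‖ ≤ C * Real.exp (-(α * N)) := by
  obtain ⟨k, hk, c, hc, hlow⟩ := hF.exists_le_norm h0 hne
  obtain ⟨ρ, hρ, hlow⟩ := Metric.eventually_nhds_iff_ball.1 hlow
  set δ := min ρ R / 2 with hδ
  have hδ0 : 0 < δ := by positivity
  have hδρ : δ < ρ := (half_lt_self (by positivity)).trans_le (min_le_left _ _)
  have hδR : δ < R := (half_lt_self (by positivity)).trans_le (min_le_right _ _)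
  set m := c * δ ^ k with hm
  have hm0 : 0 < m := by positivity
  have hlim : Tendsto (fun N : ℕ => K * θ ^ (2 * N)) atTop (𝓝 0) := by
    have h1 : Tendsto (fun N : ℕ => (θ ^ 2) ^ N) atTop (𝓝 0) :=
      tendsto_pow_atTop_nhds_zero_of_lt_one (by positivity) (by nlinarith)
    simpa [pow_mul] using h1.const_mul K
  obtain ⟨N₀, hN₀⟩ := eventually_atTop.1 (hlim.eventually (gt_mem_nhds (half_pos hm0)))
  -- At a zero of `D`, `c * ‖z - z₀‖ ^ k ≤ ‖F z‖ ≤ K * θ ^ (2 * N)`; taking `k`-th roots gives these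
  -- values of `C` and `α`.
  refine ⟨δ, hδ0, hδR, (K / c) ^ (k : ℝ)⁻¹, by positivity, -(2 * Real.log θ / k),
    neg_pos.2 (div_neg_of_neg_of_pos (by linarith [Real.log_neg hθ hθ1]) (by positivity)), N₀,
    fun N hN D hD hDF => ⟨?_, fun z hz hDz => ?_⟩⟩
  · refine exists_zero_of_norm_lt_sphere hδ0 hδR hD (m := m / 2) (fun z hz => ?_) ?_
    · have hz' : ‖z - z₀‖ = δ := by rwa [← dist_eq_norm]
      have h1 := hlow z (Metric.mem_ball.2 (by rw [dist_eq_norm, hz']; exact hδρ))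
      rw [hz'] at h1
      have h2 := hDF z (Metric.mem_ball.2 (by rw [dist_eq_norm, hz']; exact hδR))
      have h3 := norm_sub_norm_le (F z) (D z)
      rw [norm_sub_rev] at h3
      linarith [hN₀ N hN]
    · have := hDF z₀ (Metric.mem_ball_self hR)
      rw [h0, sub_zero] at this
      exact this.trans_lt (hN₀ N hN)
  · have h1 := hlow z (Metric.ball_subset_ball hδρ.le hz)
    have h2 := hDF z (Metric.ball_subset_ball hδR.le hz)
    rw [hDz, zero_sub, norm_neg] at h2
    refine (pow_le_pow_iff_left₀ (norm_nonneg _) (by positivity) hk).1 ?_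
    rw [mul_pow, Real.rpow_inv_natCast_pow (by positivity) hk, ← Real.exp_nat_mul]
    have e : Real.exp (k * -(-(2 * Real.log θ / k) * N)) = θ ^ (2 * N) := by
      have hk' : (k : ℝ) ≠ 0 := by exact_mod_cast hk
      have : (k : ℝ) * -(-(2 * Real.log θ / k) * N) = ((2 * N : ℕ) : ℝ) * Real.log θ := by
        push_cast
        field_simp
      rw [this, Real.exp_nat_mul, Real.exp_log hθ]
    rw [e, div_mul_eq_mul_div, le_div_iff₀ hc]
    linarith

/-! ### Matching at the interface and consequences of flux monotonicity -/

/-- The determinant criterion for a 2 × 2 system. The minus sign in the second row is the sign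
change of the flux under reflection of the left half-line. -/
theorem exists_ne_zero_solution_iff {p q r s : ℂ} :
    (∃ a b : ℂ, (a ≠ 0 ∨ b ≠ 0) ∧ p * a + q * b = 0 ∧ r * a - s * b = 0) ↔ p * s + q * r = 0 := by
  constructor
  · rintro ⟨a, b, hab, h1, h2⟩
    rcases hab with h | h
    · refine (mul_eq_zero.1 ?_).resolve_left h
      linear_combination s * h1 + q * h2
    · refine (mul_eq_zero.1 ?_).resolve_left h
      linear_combination r * h1 - p * h2
  · intro h
    by_cases hpq : p = 0 ∧ q = 0
    · obtain ⟨rfl, rfl⟩ := hpq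
      by_cases hrs : r = 0 ∧ s = 0
      · exact ⟨1, 0, by simp, by simp, by simp [hrs.1]⟩
      · refine ⟨s, r, ?_, by simp, by ring⟩
        by_contra hcon
        push Not at hcon
        exact hrs ⟨hcon.2, hcon.1⟩
    · refine ⟨q, -p, ?_, by ring, by linear_combination h⟩
      by_contra hcon
      push Not at hcon
      exact hpq ⟨neg_eq_zero.1 hcon.2, hcon.1⟩

namespace IsFieldOn

variable {ε μ ε₁ μ₁ ε₂ μ₂ : ℝ → ℝ} {E : ℂ} {s t : Set ℝ} {ψ q : ℝ → ℂ} {M : ℝ}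

theorem right_half (h : IsFieldOn (infiniteCoeff ε₁ ε₂) (infiniteCoeff μ₁ μ₂) E s ψ q)
    (hts : t ⊆ s) (ht : t ⊆ Ici 0) : IsFieldOn ε₂ μ₂ E t ψ q := by
  have hi : interior t ⊆ Ioi 0 := by rw [← interior_Ici]; exact interior_mono ht
  exact h.congr_coeff hts ((infiniteCoeff_eqOn_right _ _).mono hi)
    ((infiniteCoeff_eqOn_right _ _).mono hi)

theorem left_half (h : IsFieldOn (infiniteCoeff ε₁ ε₂) (infiniteCoeff μ₁ μ₂) E s ψ q)
    (hts : t ⊆ Neg.neg ⁻¹' s) (ht : t ⊆ Ici 0) :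
    IsFieldOn (fun x => ε₁ (-x)) (fun x => μ₁ (-x)) E t (fun x => ψ (-x)) (fun x => -q (-x)) := by
  have hi : ∀ x ∈ interior t, -x ∈ Iio (0 : ℝ) := fun x hx => by
    have : x ∈ Ioi (0 : ℝ) := by rw [← interior_Ici]; exact interior_mono ht hx
    exact neg_lt_zero.2 (mem_Ioi.1 this)
  exact h.reflect.congr_coeff hts (fun x hx => infiniteCoeff_eqOn_left _ _ (hi x hx))
    (fun x hx => infiniteCoeff_eqOn_left _ _ (hi x hx))

theorem eq_zero_of_data (h : IsFieldOn ε μ E s ψ q) (hm : IsMedium ε μ M) {a b : ℝ}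
    (hs : Icc a b ⊆ s) (h0 : ψ 0 = 0) (h0' : q 0 = 0) (ha : a ≤ 0) (hb : 0 ≤ b) :
    ∀ x ∈ Icc a b, ψ x = 0 := by
  intro x hx
  rcases le_total 0 x with h1 | h1
  · exact (h.eq_zero_of_left hm ((Icc_subset_Icc_left ha).trans hs) h0 h0' x ⟨h1, hx.2⟩).1
  · have hs' : Icc 0 (-a) ⊆ Neg.neg ⁻¹' s := fun y hy =>
      hs ⟨by linarith [hy.2], by linarith [hy.1]⟩
    have := (h.reflect.eq_zero_of_left hm.reflect hs' (by simpa using h0) (by simpa using h0')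
      (-x) ⟨by linarith, by linarith [hx.1]⟩).1
    simpa using this

/-- A square integrable half-line solution at a nonpositive energy with outgoing real flux
vanishes. -/
theorem eq_zero_of_nonpos_energy {E : ℝ} (h : IsFieldOn ε μ (E : ℂ) (Ici 0) ψ q)
    (hm : IsMedium ε μ M) (hE : E ≤ 0) (hi : IntegrableOn (fun x => ‖ψ x‖ ^ 2) (Ioi 0))
    (h0 : 0 ≤ (conj (ψ 0) * q 0).re) : ψ 0 = 0 ∧ q 0 = 0 := by
  have hsub : ∀ b : ℝ, Icc 0 b ⊆ Ici 0 := fun b x hx => hx.1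
  -- For `E ≤ 0` the derivative `μ * ‖q‖ ^ 2 - E * ε * ‖ψ‖ ^ 2` is nonnegative, so the sign at the
  -- origin persists and makes `‖ψ‖` nondecreasing.
  have hre : ∀ x, 0 ≤ x → 0 ≤ (conj (ψ x) * q x).re := by
    intro x hx
    have hb := h.mono (hsub x)
    have hanti : AntitoneOn (fun x => -(conj (ψ x) * q x).re) (Icc 0 x) := by
      refine hm.antitoneOn ?_ fun y hy h1 h2 => ⟨_, (HasFDerivAt.comp_hasDerivAt y
        Complex.reCLM.hasFDerivAt
        (hb.hasDerivAt_conj_mul (by rwa [interior_Icc]) h1 h2)).neg, ?_⟩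
      · exact (Complex.continuous_re.comp_continuousOn
          ((Complex.continuous_conj.comp_continuousOn hb.1).mul hb.2)).neg
      · rw [← Complex.ofReal_mul, ← Complex.ofReal_sub, Complex.reCLM_apply, Complex.ofReal_re]
        have p1 : 0 ≤ μ y * ‖q y‖ ^ 2 := mul_nonneg (hm.pos_right y).le (by positivity)
        have p2 : 0 ≤ ε y * ‖ψ y‖ ^ 2 := mul_nonneg (hm.pos_left y).le (by positivity)
        nlinarith
    have := hanti (left_mem_Icc.2 hx) (right_mem_Icc.2 hx) hx
    simp only at this
    linarith
  have hmono : ∀ x y, 0 ≤ x → x ≤ y → ‖ψ x‖ ^ 2 ≤ ‖ψ y‖ ^ 2 := by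
    intro x y hx hxy
    have hb := h.mono (hsub y)
    have hanti : AntitoneOn (fun x => -‖ψ x‖ ^ 2) (Icc 0 y) := by
      refine hm.antitoneOn (hb.1.norm.pow 2).neg fun z hz h1 h2 =>
        ⟨_, (hb.3 z (by rwa [interior_Icc]) h1 h2).norm_sq.neg, ?_⟩
      have e : inner ℝ (ψ z) (μ z * q z) = μ z * (conj (ψ z) * q z).re := by
        rw [Complex.inner, mul_assoc, Complex.re_ofReal_mul, mul_comm (q z)]
      have := mul_nonneg (hm.pos_right z).le (hre z hz.1.le)
      linarith
    have := hanti ⟨hx, hxy⟩ (right_mem_Icc.2 (hx.trans hxy)) hxy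
    simp only at this
    linarith
  have hz : ∀ x ∈ Icc (0 : ℝ) 1, ψ x = 0 := by
    intro x hx
    by_contra hne
    have hc : IntegrableOn (fun _ : ℝ => ‖ψ x‖ ^ 2) (Ioi x) := by
      refine (hi.mono_set (Ioi_subset_Ioi hx.1)).mono' aestronglyMeasurable_const ?_
      filter_upwards [ae_restrict_mem measurableSet_Ioi] with y hy
      rw [Real.norm_of_nonneg (by positivity)]
      exact hmono x y hx.1 (le_of_lt hy)
    rw [integrableOn_const_iff] at hc
    simp [hne] at hc
  exact ⟨hz 0 (by simp), h.flux_eq_zero hm one_pos (hsub 1) hz 0 (by simp)⟩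

/-- A nonzero outgoing solution with `Re ω > 0` has `Im ω < 0`. -/
theorem im_neg_of_outgoing {ω : ℂ} {a b : ℝ} (h : IsFieldOn ε μ (ω ^ 2) (Icc a b) ψ q)
    (hm : IsMedium ε μ M) (hab : a ≤ b) (hre : 0 < ω.re) (hne : ∃ x ∈ Icc a b, ψ x ≠ 0)
    (ha : q a + Complex.I * ω * ψ a = 0) (hb : q b - Complex.I * ω * ψ b = 0) : ω.im < 0 := by
  by_contra him
  rw [not_lt] at him
  have hE : 0 ≤ (ω ^ 2).im := by
    have : (ω ^ 2).im = 2 * (ω.re * ω.im) := by rw [sq, Complex.mul_im]; ring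
    rw [this]; positivity
  have hle := h.antitoneOn_im hm subset_rfl hE (left_mem_Icc.2 hab) (right_mem_Icc.2 hab) hab
  have e : ∀ z : ℂ, (conj z * (Complex.I * ω * z)).im = ω.re * ‖z‖ ^ 2 := fun z => by
    have : conj z * (Complex.I * ω * z) = Complex.I * ω * (‖z‖ ^ 2 : ℝ) := by
      push_cast
      rw [← Complex.conj_mul' z]; ring
    rw [this, Complex.im_mul_ofReal]
    simp
  have qa : q a = -(Complex.I * ω * ψ a) := by linear_combination ha
  have qb : q b = Complex.I * ω * ψ b := by linear_combination hb
  simp only [qa, qb, mul_neg, Complex.neg_im, e] at hle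
  -- The outgoing conditions turn the flux monotonicity into `Re ω * ‖ψ b‖ ^ 2 ≤ -Re ω * ‖ψ a‖ ^ 2`,
  -- so the data at `a` vanish.
  have hψ : ψ a = 0 := by
    have h1 : 0 ≤ ω.re * ‖ψ b‖ ^ 2 := by positivity
    have h2 : 0 ≤ ‖ψ a‖ ^ 2 := by positivity
    have h3 : ‖ψ a‖ ^ 2 = 0 := by nlinarith
    simpa using h3
  obtain ⟨x, hx, hx0⟩ := hne
  exact hx0 (h.eq_zero_of_left hm subset_rfl hψ (by rw [qa, hψ]; simp) x hx).1

/-- A solution on the line with nonreal energy that decays at both ends vanishes. -/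
theorem data_eq_zero_of_decay (h : IsFieldOn ε μ E univ ψ q) (hm : IsMedium ε μ M)
    (hE : 0 < E.im) (h1 : Tendsto (fun n : ℕ => ψ n) atTop (𝓝 0))
    (h2 : Tendsto (fun n : ℕ => q n) atTop (𝓝 0))
    (h3 : Tendsto (fun n : ℕ => ψ (-n)) atTop (𝓝 0))
    (h4 : Tendsto (fun n : ℕ => -q (-n)) atTop (𝓝 0)) : ψ 0 = 0 ∧ q 0 = 0 := by
  have hlim : ∀ a b : ℕ → ℂ, Tendsto a atTop (𝓝 0) → Tendsto b atTop (𝓝 0) →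
      Tendsto (fun n => (conj (a n) * b n).im) atTop (𝓝 0) := fun a b ha hb => by
    have := (Complex.continuous_conj.tendsto 0).comp ha
    rw [map_zero] at this
    have := (Complex.continuous_im.tendsto _).comp (this.mul hb)
    rwa [mul_zero, Complex.zero_im] at this
  -- The two signs are taken at different points, 1 and 0, so that the flux is constant on an
  -- interval of positive length.
  have hright : 0 ≤ (conj (ψ 1) * q 1).im := by
    refine le_of_tendsto (hlim _ _ h1 h2) (eventually_atTop.2 ⟨1, fun n hn => ?_⟩)
    have hn' : (1 : ℝ) ≤ n := by exact_mod_cast hn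
    exact h.antitoneOn_im hm (subset_univ _) hE.le (left_mem_Icc.2 hn') (right_mem_Icc.2 hn') hn'
  have hleft : (conj (ψ 0) * q 0).im ≤ 0 := by
    have h4' : Tendsto (fun n : ℕ => q (-n)) atTop (𝓝 0) := by simpa using h4.neg
    refine ge_of_tendsto (hlim _ _ h3 h4') (Eventually.of_forall fun n => ?_)
    have hn' : (-n : ℝ) ≤ 0 := by simp
    exact h.antitoneOn_im hm (subset_univ _) hE.le (left_mem_Icc.2 hn') (right_mem_Icc.2 hn') hn'
  have hz := h.eq_zero_of_im_eq hm one_pos (subset_univ _) hE (hleft.trans hright)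
  exact ⟨hz 0 (by simp), h.flux_eq_zero hm one_pos (subset_univ _) hz 0 (by simp)⟩

end IsFieldOn

/-- Resonances in terms of the coefficients of the untruncated structure. -/
theorem isResonance_iff {ε₁ μ₁ ε₂ μ₂ : ℝ → ℝ} {M : ℝ}
    (hm : IsMedium (infiniteCoeff ε₁ ε₂) (infiniteCoeff μ₁ μ₂) M) {m n : ℕ} (hmn : 0 < m)
    {ω : ℂ} :
    IsResonance (-m) n ε₁ μ₁ ε₂ μ₂ ω ↔ ∃ ψ q : ℝ → ℂ,
      IsFieldOn (infiniteCoeff ε₁ ε₂) (infiniteCoeff μ₁ μ₂) (ω ^ 2) (Icc (-m) n) ψ q ∧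
      (ψ 0 ≠ 0 ∨ q 0 ≠ 0) ∧ q (-m) + Complex.I * ω * ψ (-m) = 0 ∧
      q n - Complex.I * ω * ψ n = 0 := by
  have hm' : (-m : ℝ) < 0 := by simpa using hmn
  have hn' : (0 : ℝ) ≤ n := Nat.cast_nonneg n
  have heq : ∀ f₁ f₂ : ℝ → ℝ, EqOn (finiteCoeff (-m) n f₁ f₂) (infiniteCoeff f₁ f₂)
      (interior (Icc (-m : ℝ) n)) := fun f₁ f₂ => by
    rw [interior_Icc]
    simpa using finiteCoeff_eqOn (-m) n f₁ f₂
  simp only [IsResonance, Int.cast_neg, Int.cast_natCast]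
  constructor
  · rintro ⟨ψ, q, h, ⟨x, hx, hne⟩, h1, h2⟩
    have h' := h.congr_coeff subset_rfl (heq _ _) (heq _ _)
    refine ⟨ψ, q, h', ?_, h1, h2⟩
    by_contra hcon
    push Not at hcon
    exact hne (h'.eq_zero_of_data hm subset_rfl hcon.1 hcon.2 hm'.le hn' x hx)
  · rintro ⟨ψ, q, h, hne, h1, h2⟩
    refine ⟨ψ, q, h.congr_coeff subset_rfl (heq _ _).symm (heq _ _).symm, ?_, h1, h2⟩
    by_contra hcon
    push Not at hcon
    have h0 : (0 : ℝ) ∈ Icc (-m : ℝ) n := ⟨hm'.le, hn'⟩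
    have := h.flux_eq_zero hm (hm'.trans_le hn') subset_rfl hcon 0 h0
    simp [hcon 0 h0, this] at hne

/-! ### Assembly of the proof -/

theorem DifferentiableAt.eventually_norm_le_add_one {f : ℂ → ℂ} {z : ℂ}
    (hf : DifferentiableAt ℂ f z) : ∀ᶠ w in 𝓝 z, ‖f w‖ ≤ ‖f z‖ + 1 :=
  (hf.continuousAt.norm.eventually_lt continuousAt_const (lt_add_one _)).mono fun _ h => h.le

theorem norm_perturbation_le {a₁ a₂ b₁ b₂ c₁ c₂ d₁ d₂ u v : ℂ} {K W : ℝ} (hK : 0 ≤ K)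
    (ha₁ : ‖a₁‖ ≤ K) (ha₂ : ‖a₂‖ ≤ K) (hb₁ : ‖b₁‖ ≤ K) (hb₂ : ‖b₂‖ ≤ K) (hc₁ : ‖c₁‖ ≤ K)
    (hc₂ : ‖c₂‖ ≤ K) (hd₁ : ‖d₁‖ ≤ K) (hd₂ : ‖d₂‖ ≤ K) (hu : ‖u‖ ≤ W) (hv : ‖v‖ ≤ W)
    (hW : W ≤ 1) :
    ‖(a₁ + u * b₁) * (c₂ + v * d₂) + (a₂ + u * b₂) * (c₁ + v * d₁) - (a₁ * c₂ + a₂ * c₁)‖ ≤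
      6 * K ^ 2 * W := by
  have hW0 : 0 ≤ W := (norm_nonneg _).trans hu
  have t1 : ∀ x y w : ℂ, ‖x‖ ≤ K → ‖y‖ ≤ K → ‖w‖ ≤ W → ‖w * (x * y)‖ ≤ K ^ 2 * W := by
    intro x y w hx hy hw
    rw [norm_mul, norm_mul, mul_comm, sq]
    exact mul_le_mul (mul_le_mul hx hy (norm_nonneg _) hK) hw (norm_nonneg _) (by positivity)
  have huv : ‖u * v‖ ≤ W := by
    rw [norm_mul]
    calc ‖u‖ * ‖v‖ ≤ W * 1 := mul_le_mul hu (hv.trans hW) (norm_nonneg _) hW0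
      _ = W := mul_one W
  have e : (a₁ + u * b₁) * (c₂ + v * d₂) + (a₂ + u * b₂) * (c₁ + v * d₁) - (a₁ * c₂ + a₂ * c₁) =
      v * (a₁ * d₂) + u * (b₁ * c₂) + u * v * (b₁ * d₂) + v * (a₂ * d₁) + u * (b₂ * c₁) +
        u * v * (b₂ * d₁) := by ring
  rw [e]
  refine (norm_add_le_of_le (norm_add_le_of_le (norm_add_le_of_le (norm_add_le_of_le
    (norm_add_le_of_le (t1 _ _ _ ha₁ hd₂ hv) (t1 _ _ _ hb₁ hc₂ hu)) (t1 _ _ _ hb₁ hd₂ huv))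
    (t1 _ _ _ ha₂ hd₁ hv)) (t1 _ _ _ hb₂ hc₁ hu)) (t1 _ _ _ hb₂ hd₁ huv)).trans_eq ?_
  ring

theorem mainTheorem9 (ε₁ μ₁ ε₂ μ₂ : ℝ → ℝ)
    (hε₁ : IsPeriodicCoeff ε₁) (hμ₁ : IsPeriodicCoeff μ₁)
    (hε₂ : IsPeriodicCoeff ε₂) (hμ₂ : IsPeriodicCoeff μ₂)
    (Einf : ℝ) (ψinf : ℝ → ℂ) (hmode : IsInterfaceMode ε₁ μ₁ ε₂ μ₂ Einf ψinf)
    (ωinf : ℝ) (hω : ωinf = Real.sqrt Einf) :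
    ∃ δ > 0, ∃ C > 0, ∃ α : ℂ → ℝ,
      ContinuousOn α (Metric.closedBall (ωinf : ℂ) δ) ∧
      (∀ ω ∈ Metric.closedBall (ωinf : ℂ) δ, 0 < α ω) ∧
      ∃ N₀ : ℕ, ∀ N₁ N₂ : ℤ, N₁ < 0 → 0 < N₂ → (N₀ : ℤ) ≤ min |N₁| N₂ →
        (∃ ω ∈ Metric.ball (ωinf : ℂ) δ, IsResonance N₁ N₂ ε₁ μ₁ ε₂ μ₂ ω ∧ ω.im < 0) ∧
        (∀ ω ∈ Metric.ball (ωinf : ℂ) δ, IsResonance N₁ N₂ ε₁ μ₁ ε₂ μ₂ ω →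
          ‖ω - (ωinf : ℂ)‖ ≤ C * Real.exp (-(α ω * ((min |N₁| N₂ : ℤ) : ℝ)))) := by
  obtain ⟨hL2, ⟨x₀, hx₀⟩, qinf, hfield⟩ := hmode
  obtain ⟨M₁, hm₁⟩ := hε₁.isMedium hμ₁
  obtain ⟨M₂, hm₂⟩ := hε₂.isMedium hμ₂
  obtain ⟨M, hm⟩ : ∃ M, IsMedium (infiniteCoeff ε₁ ε₂) (infiniteCoeff μ₁ μ₂) M :=
    ⟨_, infiniteCoeff_isMedium hm₁ hm₂⟩
  have hne : ψinf 0 ≠ 0 ∨ qinf 0 ≠ 0 := by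
    by_contra hcon
    push Not at hcon
    exact hx₀ (hfield.eq_zero_of_data hm (subset_univ (Icc (-|x₀|) |x₀|)) hcon.1 hcon.2
      (by simp) (by simp) x₀ ⟨neg_abs_le _, le_abs_self _⟩)
  have hright := hfield.right_half (subset_univ (Ici 0)) subset_rfl
  have hleft := hfield.left_half (t := Ici 0) (fun _ _ => mem_univ _) subset_rfl
  have hint : Integrable (fun x => ‖ψinf x‖ ^ 2) volume := hL2.integrable_norm_pow two_ne_zero
  have hintR : IntegrableOn (fun x => ‖ψinf x‖ ^ 2) (Ioi 0) := hint.integrableOn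
  have hintL : IntegrableOn (fun x => ‖ψinf (-x)‖ ^ 2) (Ioi 0) := hint.comp_neg.integrableOn
  have hneL : ψinf (-0) ≠ 0 ∨ -qinf (-0) ≠ 0 := by simpa using hne
  have hEpos : 0 < Einf := by
    by_contra hE
    rw [not_lt] at hE
    -- Reflection reverses the sign of the flux, so one of the two half-lines always meets the sign
    -- condition.
    rcases le_total 0 (conj (ψinf 0) * qinf 0).re with h | h
    · have := hright.eq_zero_of_nonpos_energy hm₂ hE hintR h
      simp [this.1, this.2] at hne
    · have := hleft.eq_zero_of_nonpos_energy hm₁.reflect hE hintL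
        (by rw [neg_zero, mul_neg, Complex.neg_re]; linarith)
      simp only [neg_zero] at this
      simp [this.1, neg_eq_zero.1 this.2] at hne
  have hω0 : 0 < ωinf := hω ▸ Real.sqrt_pos.2 hEpos
  have hsq : (Einf : ℂ) = (ωinf : ℂ) ^ 2 := by
    rw [hω]; exact_mod_cast (Real.sq_sqrt hEpos.le).symm
  rw [hsq] at hright hleft
  obtain ⟨θ₂, hθ₂, hθ₂1, l₂, a₁, a₂, b₁, b₂, hevR, hR0⟩ :=
    exists_outgoing_asymptotics hε₂ hμ₂ hω0 hright hintR hne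
  obtain ⟨θ₁, hθ₁, hθ₁1, l₁, c₁, c₂, d₁, d₂, hevL, hL0⟩ :=
    exists_outgoing_asymptotics hε₁.reflect hμ₁.reflect hω0 hleft hintL hneL
  simp only [neg_zero] at hL0
  set F : ℂ → ℂ := fun ω => a₁ ω * c₂ ω + a₂ ω * c₁ ω with hF
  obtain ⟨⟨-, da₁, da₂, db₁, db₂⟩, -⟩ := hevR.self_of_nhds
  obtain ⟨⟨-, dc₁, dc₂, dd₁, dd₂⟩, -⟩ := hevL.self_of_nhds
  have hF0 : F ωinf = 0 :=
    exists_ne_zero_solution_iff.1 ⟨ψinf 0, qinf 0, hne, hR0, by linear_combination hL0⟩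
  have hFan : AnalyticAt ℂ F ωinf := by
    refine Complex.analyticAt_iff_eventually_differentiableAt.2 ?_
    filter_upwards [hevR, hevL] with ω hR hL
    exact (hR.1.2.1.mul hL.1.2.2.1).add (hR.1.2.2.1.mul hL.1.2.1)
  have hre : ∀ᶠ ω in 𝓝 (ωinf : ℂ), 0 < ω.re :=
    continuousAt_const.eventually_lt Complex.continuous_re.continuousAt (by simpa using hω0)
  have hFne : ¬∀ᶠ ω in 𝓝 (ωinf : ℂ), F ω = 0 := by
    intro hFz
    obtain ⟨r, hr, hball⟩ := Metric.eventually_nhds_iff_ball.1 (hFz.and (hevR.and hevL))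
    -- A test point above the real axis: `ω ^ 2` has positive imaginary part, where decay at both
    -- ends is impossible.
    set ω : ℂ := ωinf + (r / 2 : ℝ) * Complex.I with hωdef
    have hmem : ω ∈ Metric.ball (ωinf : ℂ) r := by
      rw [Metric.mem_ball, dist_eq_norm, hωdef, add_sub_cancel_left, norm_mul, Complex.norm_I,
        mul_one, Complex.norm_real, Real.norm_of_nonneg (by positivity)]
      exact half_lt_self hr
    obtain ⟨hz, ⟨-, -, -, -, hdecR⟩, -, -, -, -, hdecL⟩ := hball ω hmem
    obtain ⟨a, b, hab, e1, e2⟩ := exists_ne_zero_solution_iff.2 hz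
    obtain ⟨Ψ, Q, hsol, -⟩ := hm.exists_isFieldOn a b
    obtain ⟨hs, hs1, hs2⟩ := hsol (ω ^ 2)
    have tR := hdecR _ _ (hs.right_half (subset_univ (Ici 0)) subset_rfl)
      (by rw [hs1, hs2]; exact e1)
    have tL := hdecL _ _ (hs.left_half (t := Ici 0) (fun _ _ => mem_univ _) subset_rfl)
      (by simp only [neg_zero, hs1, hs2]; linear_combination e2)
    have him : 0 < (ω ^ 2).im := by
      have : (ω ^ 2).im = 2 * (ω.re * ω.im) := by rw [sq, Complex.mul_im]; ring
      rw [this]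
      simp [hωdef, hω0, hr]
    have := hs.data_eq_zero_of_decay hm him tR.1 tR.2 tL.1 tL.2
    rw [hs1, hs2] at this
    simp [this.1, this.2] at hab
  obtain ⟨K, hK, hbd⟩ : ∃ K > 0, ∀ᶠ ω in 𝓝 (ωinf : ℂ),
      (‖a₁ ω‖ ≤ K ∧ ‖a₂ ω‖ ≤ K ∧ ‖b₁ ω‖ ≤ K ∧ ‖b₂ ω‖ ≤ K) ∧
        ‖c₁ ω‖ ≤ K ∧ ‖c₂ ω‖ ≤ K ∧ ‖d₁ ω‖ ≤ K ∧ ‖d₂ ω‖ ≤ K := by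
    refine ⟨‖a₁ ωinf‖ + ‖a₂ ωinf‖ + ‖b₁ ωinf‖ + ‖b₂ ωinf‖ + ‖c₁ ωinf‖ + ‖c₂ ωinf‖ + ‖d₁ ωinf‖ +
      ‖d₂ ωinf‖ + 1, by positivity, ?_⟩
    filter_upwards [da₁.eventually_norm_le_add_one, da₂.eventually_norm_le_add_one,
      db₁.eventually_norm_le_add_one, db₂.eventually_norm_le_add_one,
      dc₁.eventually_norm_le_add_one, dc₂.eventually_norm_le_add_one,
      dd₁.eventually_norm_le_add_one, dd₂.eventually_norm_le_add_one]
      with ω h1 h2 h3 h4 h5 h6 h7 h8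
    have n1 := norm_nonneg (a₁ ωinf)
    have n2 := norm_nonneg (a₂ ωinf)
    have n3 := norm_nonneg (b₁ ωinf)
    have n4 := norm_nonneg (b₂ ωinf)
    have n5 := norm_nonneg (c₁ ωinf)
    have n6 := norm_nonneg (c₂ ωinf)
    have n7 := norm_nonneg (d₁ ωinf)
    have n8 := norm_nonneg (d₂ ωinf)
    refine ⟨⟨?_, ?_, ?_, ?_⟩, ?_, ?_, ?_, ?_⟩ <;> linarith
  obtain ⟨R, hR, hball⟩ := Metric.eventually_nhds_iff_ball.1
    (hevR.and (hevL.and (hre.and hbd)))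
  set θ := max θ₁ θ₂ with hθ
  have hθ0 : 0 < θ := hθ₁.trans_le (le_max_left _ _)
  have hθ1 : θ < 1 := max_lt hθ₁1 hθ₂1
  obtain ⟨δ, hδ, hδR, C, hC, α, hα, N₀, hmain⟩ := hFan.exists_zeros_of_perturbation hF0 hFne
    hθ0 hθ1 (show 0 < 6 * K ^ 2 by positivity) hR
  refine ⟨δ, hδ, C, hC, fun _ => α, continuousOn_const, fun _ _ => hα, N₀, ?_⟩
  intro N₁ N₂ hN₁ hN₂ hN
  obtain ⟨m, rfl⟩ : ∃ m : ℕ, N₁ = -(m : ℤ) := ⟨N₁.natAbs, by omega⟩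
  obtain ⟨n, rfl⟩ : ∃ n : ℕ, N₂ = (n : ℤ) := ⟨N₂.toNat, by omega⟩
  have hm0 : 0 < m := by omega
  have hmin : min |(-(m : ℤ))| (n : ℤ) = ((min m n : ℕ) : ℤ) := by
    rw [abs_neg, Nat.abs_cast, Nat.cast_min]
  rw [hmin] at hN ⊢
  set N := min m n with hNdef
  -- The determinant of the two outgoing conditions at finite length; dropping the powers of `l₁`
  -- and `l₂` leaves `F`.
  set D : ℂ → ℂ := fun ω => (a₁ ω + l₂ ω ^ (2 * n) * b₁ ω) * (c₂ ω + l₁ ω ^ (2 * m) * d₂ ω) +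
    (a₂ ω + l₂ ω ^ (2 * n) * b₂ ω) * (c₁ ω + l₁ ω ^ (2 * m) * d₁ ω) with hD
  have hres : ∀ ω ∈ Metric.ball (ωinf : ℂ) R,
      IsResonance (-m) n ε₁ μ₁ ε₂ μ₂ ω ↔ D ω = 0 := by
    intro ω hωR
    obtain ⟨⟨-, hl₂, -, hoR, -⟩, ⟨-, hl₁, -, hoL, -⟩, -⟩ := hball ω hωR
    rw [isResonance_iff hm hm0]
    have key : ∀ ψ q : ℝ → ℂ, IsFieldOn (infiniteCoeff ε₁ ε₂) (infiniteCoeff μ₁ μ₂) (ω ^ 2)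
        (Icc (-m) n) ψ q →
        ((q n - Complex.I * ω * ψ n = 0 ↔
          (a₁ ω + l₂ ω ^ (2 * n) * b₁ ω) * ψ 0 + (a₂ ω + l₂ ω ^ (2 * n) * b₂ ω) * q 0 = 0) ∧
        (q (-m) + Complex.I * ω * ψ (-m) = 0 ↔
          (c₁ ω + l₁ ω ^ (2 * m) * d₁ ω) * ψ 0 - (c₂ ω + l₁ ω ^ (2 * m) * d₂ ω) * q 0 = 0)) := by
      intro ψ q h
      have e1 := hoR n _ _ (h.right_half (t := Icc 0 (n : ℝ))
        (Icc_subset_Icc_left (by simp)) fun x hx => hx.1)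
      have e2 := hoL m _ _ (h.left_half (t := Icc 0 (m : ℝ))
        (fun x hx => ⟨neg_le_neg hx.2, (neg_nonpos.2 hx.1).trans (Nat.cast_nonneg n)⟩)
        fun x hx => hx.1)
      simp only [neg_zero] at e2
      constructor
      · rw [← e1, mul_eq_zero_iff_left (pow_ne_zero _ hl₂)]
      · rw [show (c₁ ω + l₁ ω ^ (2 * m) * d₁ ω) * ψ 0 - (c₂ ω + l₁ ω ^ (2 * m) * d₂ ω) * q 0 =
          l₁ ω ^ m * (-q (-m) - Complex.I * ω * ψ (-m)) by rw [e2]; ring,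
          mul_eq_zero_iff_left (pow_ne_zero _ hl₁), ← neg_add', neg_eq_zero]
    constructor
    · rintro ⟨ψ, q, h, hnz, h1, h2⟩
      exact exists_ne_zero_solution_iff.1 ⟨ψ 0, q 0, hnz, (key ψ q h).1.1 h2, (key ψ q h).2.1 h1⟩
    · intro h0
      obtain ⟨a, b, hab, e1, e2⟩ := exists_ne_zero_solution_iff.2 h0
      obtain ⟨Ψ, Q, hsol, -⟩ := hm.exists_isFieldOn a b
      obtain ⟨hs, hs1, hs2⟩ := hsol (ω ^ 2)
      have hs' := hs.mono (subset_univ (Icc (-m : ℝ) n))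
      refine ⟨Ψ (ω ^ 2), Q (ω ^ 2), hs', by rwa [hs1, hs2], (key _ _ hs').2.2 ?_,
        (key _ _ hs').1.2 ?_⟩
      · rwa [hs1, hs2]
      · rwa [hs1, hs2]
  have hDd : DifferentiableOn ℂ D (Metric.ball (ωinf : ℂ) R) := by
    intro ω hωR
    obtain ⟨⟨⟨e0, e1, e2, e3, e4⟩, -⟩, ⟨⟨f0, f1, f2, f3, f4⟩, -⟩, -⟩ := hball ω hωR
    exact (((e1.add ((e0.pow _).mul e3)).mul (f2.add ((f0.pow _).mul f4))).add
      ((e2.add ((e0.pow _).mul e4)).mul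
        (f1.add ((f0.pow _).mul f3)))).differentiableWithinAt
  have hDF : ∀ ω ∈ Metric.ball (ωinf : ℂ) R, ‖D ω - F ω‖ ≤ 6 * K ^ 2 * θ ^ (2 * N) := by
    intro ω hωR
    obtain ⟨⟨-, -, hlR, -⟩, ⟨-, -, hlL, -⟩, -, ⟨k1, k2, k3, k4⟩, k5, k6, k7, k8⟩ := hball ω hωR
    have hpow : ∀ (z : ℂ) (j : ℕ), ‖z‖ ≤ θ → N ≤ j → ‖z ^ (2 * j)‖ ≤ θ ^ (2 * N) := by
      intro z j hz hj
      rw [norm_pow]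
      exact (pow_le_pow_left₀ (norm_nonneg _) hz _).trans
        (pow_le_pow_of_le_one hθ0.le hθ1.le (by omega))
    exact norm_perturbation_le hK.le k1 k2 k3 k4 k5 k6 k7 k8
      (hpow _ _ (hlR.trans (le_max_right _ _)) (min_le_right _ _))
      (hpow _ _ (hlL.trans (le_max_left _ _)) (min_le_left _ _))
      (pow_le_one₀ hθ0.le hθ1.le)
  obtain ⟨⟨ω, hωδ, hDω⟩, hbound⟩ := hmain N (by exact_mod_cast hN) D hDd hDF
  have hδsub := Metric.ball_subset_ball (x := (ωinf : ℂ)) hδR.le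
  refine ⟨⟨ω, hωδ, (hres ω (hδsub hωδ)).2 hDω, ?_⟩, fun ω' hω' hr => ?_⟩
  · obtain ⟨ψ, q, hsol, hnz, h1, h2⟩ := (hres ω (hδsub hωδ)).2 hDω
    have hcoeff := finiteCoeff_isMedium (-m) n hm
    push_cast at hsol h1 h2 hnz
    exact hsol.im_neg_of_outgoing hcoeff (by linarith [(Nat.cast_nonneg n : (0 : ℝ) ≤ n),
      (Nat.cast_nonneg m : (0 : ℝ) ≤ m)]) (hball ω (hδsub hωδ)).2.2.1 hnz h1 h2
  · simpa using hbound ω' hω' ((hres ω' (hδsub hω')).1 hr)
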